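/- **Setting.** Let $V$ be a finite set of nodes, each with a finite-dimensional Hilbert space, let $E$ be a finite set of nonempty subsets (hyperedges) of $V$, and let $H=\sum_{e\in E}P_e$ be a frustration-free Hamiltonian: each $P_e$ is an orthogonal projector that acts only on the nodes in $e$, and the $P_e$ have a common nonzero null vector. Put $Q_e=1-P_e$, and let $Q_0$ be the projector onto the ground space $\ker H$ (so $Q_0=|\Psi_H\rangle\langle\Psi_H|$ if the ground state $|\Psi_H\rangle$ is unique). Let - $\gamma$ be the smallest nonzero eigenvalue of $H$; - $g$ be the smallest integer $j$ such that each $P_e$ commutes with all other $P_{e'}$ except for at most $j$ of them; assume $g\ge 1$, i.e. the projectors do not all commute; - $s=\max_{e\ne e'}s_{ee'}$, where $s_{ee'}$ is the largest singular value of $P_eP_{e'}$ that is not equal to $1$ ($s_{ee'}=0$ if all singular values are equal to $1$). For each $e\in E$ let $\Omega_e$ be a bond verification operator, that is, an operator acting only on the nodes in $e$ with $Q_e\le\Omega_e\le 1$ and $\Omega_eQ_e=Q_e$; let $\nu_e=1-\|\Omega_e-Q_e\|$ be its spectral gap and $\nu_E=\min_{e\in E}\nu_e$. Let $\mathscr M=\{M_l\}_{l=1}^m$,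 $m\ge2$, be a matching cover: each $M_l\subseteq E$ consists of pairwise disjoint edges, and $\bigcup_lM_l=E$. The matching protocol has the verification operator $$\Omega(\mathscr M)=\frac1m\sum_{l=1}^m\prod_{e\in M_l}\Omega_e ,$$ with spectral gap $\nu(\Omega(\mathscr M))=1-\|\Omega(\mathscr M)-Q_0\|$. Let $$f_m(x)=\begin{cases}\dfrac{\sqrt{1+x}-1}{\sqrt{1+x}}, & m=2,\\[2ex] \dfrac{\sqrt{1+x}-1}{\sqrt{1+x}+1}, & m\ge3.\end{cases}$$ **Theorem 1.** One has $$\nu(\Omega(\mathscr M))\ \ge\ \frac{\nu_E}{m}\,f_m\!\Bigl(\frac{\gamma}{s^2g^2}\Bigr),$$ and if $\gamma\le g^2$ (in particular if $\gamma\le1$), then moreover $$\frac{\nu_E}{m}\,f_m\!\Bigl(\frac{\gamma}{s^2g^2}\Bigr)\ \ge\ \frac{\nu_E\gamma}{6mg^2}.$$ Suppose in addition that $\nu_E>0$ and $0<\epsilon,\delta<1$. Let $N$ be the number of tests required to verify the ground space within infidelity $\epsilon$ and significance level $\delta$: the smallest $n$ such that all states $\sigma_1,\dots,\sigma_n$ with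 average fidelity $\frac1n\sum_i\operatorname{tr}(Q_0\sigma_i)\le1-\epsilon$ satisfy $\prod_{i}\operatorname{tr}(\Omega(\mathscr M)\sigma_i)\le\delta$. Then $N$ exists and $$N=\biggl\lceil\frac{\ln\delta}{\ln[1-\nu(\Omega(\mathscr M))\epsilon]}\biggr\rceil\ \le\ \biggl\lceil\frac{m\ln(\delta^{-1})}{\nu_E\,\epsilon\, f_m\bigl(\frac{\gamma}{s^2g^2}\bigr)}\biggr\rceil ,$$ and if $\gamma\le g^2$, then the right-hand side is at most $\Bigl\lceil\dfrac{6mg^2\ln(\delta^{-1})}{\nu_E\gamma\epsilon}\Bigr\rceil$. -/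

import Mathlib

noncomputable section

namespace FrustrationFree

variable {V : Type*} [Fintype V] [DecidableEq V]

/-- The Hilbert space `⨂ᵥ ℂ^(d v)` of a system with one node for each `v : V`, realised as the
`ℓ²` space over the product basis. -/
abbrev Hilb (d : V → ℕ) : Type _ := EuclideanSpace ℂ ((v : V) → Fin (d v))

/-- Linear operators on the Hilbert space, with the operator norm and the Loewner order. -/
abbrev Op (d : V → ℕ) : Type _ := Hilb d →L[ℂ] Hilb d

/-- The matrix of `A ⊗ 1`, where `A` acts on the nodes in `e` and `1` on all other nodes. -/
def extendMatrix {d : V → ℕ} (e : Finset V)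
    (A : Matrix ((v : e) → Fin (d v)) ((v : e) → Fin (d v)) ℂ) :
    Matrix ((v : V) → Fin (d v)) ((v : V) → Fin (d v)) ℂ :=
  fun x y => if ∀ v, v ∉ e → x v = y v then A (fun v => x v) (fun v => y v) else 0

/-- `T` acts only on the nodes in `e`: it is of the form `A ⊗ 1`. -/
def ActsOn {d : V → ℕ} (e : Finset V) (T : Op d) : Prop :=
  ∃ A : Matrix ((v : e) → Fin (d v)) ((v : e) → Fin (d v)) ℂ,
    T = Matrix.toEuclideanCLM (𝕜 := ℂ) (extendMatrix e A)

/-- The entries of a product of two operators on disjoint sets of nodes. -/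
theorem extendMatrix_mul_apply {d : V → ℕ} {e f : Finset V} (hef : Disjoint e f)
    (A : Matrix ((v : e) → Fin (d v)) ((v : e) → Fin (d v)) ℂ)
    (B : Matrix ((v : f) → Fin (d v)) ((v : f) → Fin (d v)) ℂ)
    (x z : (v : V) → Fin (d v)) :
    (extendMatrix e A * extendMatrix f B) x z =
      if ∀ v, v ∉ e → v ∉ f → x v = z v then
        A (fun v => x v) (fun v => z v) * B (fun v => x v) (fun v => z v) else 0 := by
  rw [Matrix.mul_apply, Finset.sum_eq_single fun v => if v ∈ e then z v else x v]
  · have h1 : ∀ v, v ∉ e → x v = (if v ∈ e then z v else x v) := fun v hv => by simp [hv]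
    have h2 : (fun v : e => if (v : V) ∈ e then z v else x v) = fun v : e => z v := by
      funext v; simp
    have h3 : (fun v : f => if (v : V) ∈ e then z v else x v) = fun v : f => x v := by
      funext v
      have : (v : V) ∉ e := Finset.disjoint_right.1 hef v.2
      simp [this]
    have h4 : (∀ v, v ∉ f → (if v ∈ e then z v else x v) = z v) ↔
        ∀ v, v ∉ e → v ∉ f → x v = z v := by
      constructor
      · intro h v hv hv'
        simpa [hv] using h v hv'
      · intro h v hv
        by_cases hve : v ∈ e
        · simp [hve]
        · simpa [hve] using h v hve hv
    simp only [extendMatrix]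
    rw [if_pos h1, h2, h3]
    by_cases h : ∀ v, v ∉ e → v ∉ f → x v = z v
    · rw [if_pos h, if_pos (h4.2 h)]
    · rw [if_neg h, if_neg (fun h' => h (h4.1 h')), mul_zero]
  · intro y _ hy
    simp only [extendMatrix]
    by_cases h1 : ∀ v, v ∉ e → x v = y v
    · rw [if_neg (c := ∀ v, v ∉ f → y v = z v), mul_zero]
      intro h2
      refine hy (funext fun v => ?_)
      by_cases hv : v ∈ e
      · rw [if_pos hv]; exact h2 v (Finset.disjoint_left.1 hef hv)
      · rw [if_neg hv]; exact (h1 v hv).symm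
    · rw [if_neg h1, zero_mul]
  · intro h; exact absurd (Finset.mem_univ _) h

theorem extendMatrix_mul_comm {d : V → ℕ} {e f : Finset V} (hef : Disjoint e f)
    (A : Matrix ((v : e) → Fin (d v)) ((v : e) → Fin (d v)) ℂ)
    (B : Matrix ((v : f) → Fin (d v)) ((v : f) → Fin (d v)) ℂ) :
    extendMatrix e A * extendMatrix f B = extendMatrix f B * extendMatrix e A := by
  ext x z
  rw [extendMatrix_mul_apply hef, extendMatrix_mul_apply hef.symm]
  have h : (∀ v, v ∉ e → v ∉ f → x v = z v) ↔ ∀ v, v ∉ f → v ∉ e → x v = z v :=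
    ⟨fun h v h1 h2 => h v h2 h1, fun h v h1 h2 => h v h2 h1⟩
  by_cases hc : ∀ v, v ∉ e → v ∉ f → x v = z v
  · rw [if_pos hc, if_pos (h.1 hc), mul_comm]
  · rw [if_neg hc, if_neg (fun h' => hc (h.2 h'))]

/-- Operators on disjoint sets of nodes commute. -/
theorem ActsOn.commute {d : V → ℕ} {e f : Finset V} (hef : Disjoint e f) {S T : Op d}
    (hS : ActsOn e S) (hT : ActsOn f T) : Commute S T := by
  obtain ⟨A, rfl⟩ := hS
  obtain ⟨B, rfl⟩ := hT
  change _ * _ = _ * _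
  rw [← map_mul, ← map_mul, extendMatrix_mul_comm hef A B]

/-- A frustration-free Hamiltonian `H = ∑ₑ Pₑ`: a hypergraph on `V` with set `edges` of (nonempty)
hyperedges, and for each edge `e` an orthogonal projector `P e` that acts only on the nodes in `e`;
the projectors share a common null vector. Values of `P` outside `edges` play no role. -/
structure Hamiltonian (d : V → ℕ) where
  edges : Finset (Finset V)
  edge_nonempty : ∀ e ∈ edges, e.Nonempty
  P : Finset V → Op d
  isProj : ∀ e ∈ edges, IsStarProjection (P e)
  isLocal : ∀ e ∈ edges, ActsOn e (P e)
  frustrationFree : ∃ ψ : Hilb d, ψ ≠ 0 ∧ ∀ e ∈ edges, P e ψ = 0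

namespace Hamiltonian

variable {d : V → ℕ} (H : Hamiltonian d)

/-- The Hamiltonian `H = ∑ₑ Pₑ` as an operator. -/
def op : Op d := ∑ e ∈ H.edges, H.P e

/-- The projector `Qₑ = 1 - Pₑ`. -/
def Q (e : Finset V) : Op d := 1 - H.P e

/-- The orthogonal projector onto the ground space, that is, the null space of `H`. -/
def groundProj : Op d := (LinearMap.ker (H.op : Hilb d →ₗ[ℂ] Hilb d)).starProjection

/-- The spectral gap `γ` of `H`: its smallest nonzero eigenvalue. -/
def gap : ℝ :=
  sInf {x : ℝ | x ≠ 0 ∧ Module.End.HasEigenvalue (H.op : Module.End ℂ (Hilb d)) (x : ℂ)}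

open Classical in
/-- The smallest integer `g` such that each `P e` commutes with all other `P e'` except for at
most `g` of them. -/
def noncommDegree : ℕ :=
  H.edges.sup fun e => (H.edges.filter fun e' => e' ≠ e ∧ ¬ Commute (H.P e) (H.P e')).card

/-- The largest singular value of `Pₑ Pₑ'` that is not equal to `1`, and `0` if there is none
(in Mathlib, the sequence of singular values is padded with zeros). -/
def pairSingular (e e' : Finset V) : ℝ :=
  sSup {x : ℝ | x ≠ 1 ∧
    ∃ i, ((H.P e * H.P e' : Op d) : Hilb d →ₗ[ℂ] Hilb d).singularValues i = x}

/-- `s`, the maximum over all pairs of distinct edges of `pairSingular`. -/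
def maxSingular : ℝ :=
  sSup {x : ℝ | ∃ e ∈ H.edges, ∃ e' ∈ H.edges, e ≠ e' ∧ H.pairSingular e e' = x}

end Hamiltonian

/-- The spectral gap `ν(Ω) = 1 - ‖Ω - Q‖` of a verification operator `Ω` for the range of the
projector `Q`. -/
def verificationGap {d : V → ℕ} (Q Ω : Op d) : ℝ := 1 - ‖Ω - Q‖

/-- A choice of a bond verification operator `Ω e`, acting on the nodes in `e`, for each edge. -/
structure BondVerification {d : V → ℕ} (H : Hamiltonian d) where
  Ω : Finset V → Op d
  isLocal : ∀ e ∈ H.edges, ActsOn e (Ω e)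
  Q_le : ∀ e ∈ H.edges, H.Q e ≤ Ω e
  le_one : ∀ e ∈ H.edges, Ω e ≤ 1
  mul_Q : ∀ e ∈ H.edges, Ω e * H.Q e = H.Q e

/-- `ν_E`, the minimum over the edges of the spectral gaps of the bond verification operators. -/
def BondVerification.minGap {d : V → ℕ} {H : Hamiltonian d} (B : BondVerification H) : ℝ :=
  sInf {x : ℝ | ∃ e ∈ H.edges, verificationGap (H.Q e) (B.Ω e) = x}

/-- A family of `m` matchings (sets of pairwise disjoint edges) that covers the edge set. -/
structure MatchingCover (E : Finset (Finset V)) (m : ℕ) where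
  M : Fin m → Finset (Finset V)
  subset : ∀ l, M l ⊆ E
  matching : ∀ l, ∀ e ∈ M l, ∀ e' ∈ M l, e ≠ e' → Disjoint e e'
  cover : ∀ e ∈ E, ∃ l, e ∈ M l

section Protocol

variable {d : V → ℕ} {H : Hamiltonian d} (B : BondVerification H) {m : ℕ}
  (C : MatchingCover H.edges m)

/-- The test operator `∏_{e ∈ M_l} Ωₑ` (the factors commute). -/
def testOp (l : Fin m) : Op d :=
  (C.M l).noncommProd B.Ω fun e he e' he' hne =>
    ActsOn.commute (C.matching l e he e' he' hne)
      (B.isLocal e (C.subset l he)) (B.isLocal e' (C.subset l he'))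

/-- The verification operator of the matching protocol: the uniform mixture of the tests. -/
def matchingOp : Op d := (m : ℂ)⁻¹ • ∑ l, testOp B C l

end Protocol

/-- Density operators. -/
def IsState {d : V → ℕ} (σ : Op d) : Prop :=
  0 ≤ σ ∧ LinearMap.trace ℂ (Hilb d) (σ : Hilb d →ₗ[ℂ] Hilb d) = 1

/-- `tr(T σ)`: the probability that the state `σ` passes the test `T`, or, if `T` is a projector,
the fidelity of `σ` with the range of `T`. -/
def passProb {d : V → ℕ} (T σ : Op d) : ℝ :=
  (LinearMap.trace ℂ (Hilb d) ((T * σ : Op d) : Hilb d →ₗ[ℂ] Hilb d)).re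

/-- `n` tests with verification operator `Ω` verify the range of `Q` within infidelity `ε` and
significance level `δ`: if `n` states have average fidelity at most `1 - ε`, then
they pass all `n` tests with probability at most `δ`. -/
def Verifies {d : V → ℕ} (Q Ω : Op d) (ε δ : ℝ) (n : ℕ) : Prop :=
  ∀ σ : Fin n → Op d, (∀ i, IsState (σ i)) →
    ∑ i, passProb Q (σ i) ≤ n * (1 - ε) → ∏ i, passProb Ω (σ i) ≤ δ

/-- The function `f_m`, for `m ≥ 2`. -/
def f (m : ℕ) (x : ℝ) : ℝ :=
  if m = 2 then (√(1 + x) - 1) / √(1 + x) else (√(1 + x) - 1) / (√(1 + x) + 1)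

end FrustrationFree

end

/-! Let y be orthogonal to the ground space. Assign each edge to one matching that contains it, and
let R_l be the product of the Q_e over the edges assigned to M_l, a projector because disjoint edges
give commuting factors. From Ω_e ≤ 1 - ν_E (1 - Q_e) the l-th test is at most 1 - ν_E (1 - R_l)
(`list_prod_le_one_sub_smul`), so the gap bound reduces to ∑ ‖y - R_l y‖² ≥ f_m ‖y‖².

The product of all R_l contains each Q_e exactly once, so by the detectability lemma
(`norm_prod_Q_le`) it shrinks vectors orthogonal to the ground space by c = 1/√(1 + γ/(s²g²)). That
lemma compares two estimates for the image φ of ψ: γ‖φ‖² ≤ ∑ ‖P_e φ‖² by definition of the gap, and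
∑ ‖P_e φ‖² ≤ s²g²(‖ψ‖² - ‖φ‖²), because once Q_e has been applied only non-commuting factors can
bring back a component in the range of P_e, each by at most s times what it removes
(`exists_removed_norms`).

Conversely, if every R_l nearly fixed y, so would their product. The quantum union bound makes this
quantitative with constant (1 - c)/(1 + c); for two projectors a direct argument gives 1 - c. These
are the two branches of f_m.

For the number of tests, AM-GM and an extremal mixture of a ground state with a top eigenvector of Ω
- Q_0 show that n tests suffice exactly when (1 - νε)^n ≤ δ (`verifies_iff`). The bound on N is then
ln(1 - x) ≤ -x, and the constant 6 comes from (√2 + 1)² < 6. -/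

noncomputable section

namespace FrustrationFree

/-! ### Quadratic forms, projectors and singular values of a product of two projectors -/

section Abstract

variable {E : Type*} [NormedAddCommGroup E] [InnerProductSpace ℂ E] [FiniteDimensional ℂ E]

open Module in
theorem re_inner_eq_sum_eigenvalues {T : E →ₗ[ℂ] E} (hT : T.IsSymmetric) (x : E) :
    (inner ℂ (T x) x).re = ∑ i, hT.eigenvalues (n := finrank ℂ E) rfl i *
      ‖inner ℂ (hT.eigenvectorBasis (n := finrank ℂ E) rfl i) x‖ ^ 2 := by
  rw [← (hT.eigenvectorBasis rfl).sum_inner_mul_inner (T x) x, Complex.re_sum]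
  refine Finset.sum_congr rfl fun i _ => ?_
  rw [hT, hT.apply_eigenvectorBasis, inner_smul_right, mul_assoc, ← inner_conj_symm x,
    RCLike.conj_mul]
  norm_cast

open Module in
/-- If every eigenvector of `T` with eigenvalue less than `c` is orthogonal to `x`, then
`c ‖x‖² ≤ ⟨T x, x⟩`. -/
theorem mul_sq_norm_le_re_inner {T : E →ₗ[ℂ] E} (hT : T.IsSymmetric) (x : E) (c : ℝ)
    (h : ∀ (μ : ℝ) (b : E), End.HasEigenvector T μ b → μ < c → inner ℂ b x = 0) :
    c * ‖x‖ ^ 2 ≤ (inner ℂ (T x) x).re := by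
  rw [re_inner_eq_sum_eigenvalues hT, ← (hT.eigenvectorBasis rfl).sum_sq_norm_inner_right x,
    Finset.mul_sum]
  refine Finset.sum_le_sum fun i _ => ?_
  rcases lt_or_ge (hT.eigenvalues rfl i) c with hlt | hge
  · rw [h _ _ (hT.hasEigenvector_eigenvectorBasis rfl i) hlt]; simp
  · gcongr

open Module in
theorem re_inner_le_mul_sq_norm {T : E →ₗ[ℂ] E} (hT : T.IsSymmetric) (x : E) (c : ℝ)
    (h : ∀ i, hT.eigenvalues (n := finrank ℂ E) rfl i ≤ c ∨
      inner ℂ (hT.eigenvectorBasis (n := finrank ℂ E) rfl i) x = 0) :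
    (inner ℂ (T x) x).re ≤ c * ‖x‖ ^ 2 := by
  rw [re_inner_eq_sum_eigenvalues hT, ← (hT.eigenvectorBasis rfl).sum_sq_norm_inner_right x,
    Finset.mul_sum]
  refine Finset.sum_le_sum fun i _ => ?_
  rcases h i with h | h
  · gcongr
  · rw [h]; simp

variable {P Q : E →L[ℂ] E}

theorem IsStarProjection.inner_apply (hP : IsStarProjection P) (x y : E) :
    inner ℂ (P x) y = inner ℂ x (P y) :=
  hP.isSelfAdjoint.isSymmetric x y

theorem IsStarProjection.apply_apply (hP : IsStarProjection P) (x : E) : P (P x) = P x :=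
  congr($(hP.isIdempotentElem.eq) x)

theorem IsStarProjection.sq_norm_sub (hP : IsStarProjection P) (x : E) :
    ‖x - P x‖ ^ 2 = ‖x‖ ^ 2 - ‖P x‖ ^ 2 := by
  have h : inner ℂ (x - P x) (P x) = 0 := by
    rw [← IsStarProjection.inner_apply hP, map_sub, IsStarProjection.apply_apply hP]; simp
  have := norm_add_sq_eq_norm_sq_add_norm_sq_of_inner_eq_zero (𝕜 := ℂ) _ _ h
  rw [sub_add_cancel] at this
  nlinarith

theorem IsStarProjection.norm_apply_le (hP : IsStarProjection P) (x : E) : ‖P x‖ ≤ ‖x‖ := by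
  have := IsStarProjection.sq_norm_sub hP x
  exact le_of_sq_le_sq (by nlinarith [sq_nonneg ‖x - P x‖]) (norm_nonneg _)

theorem IsStarProjection.norm_sub_le (hP : IsStarProjection P) (x : E) : ‖x - P x‖ ≤ ‖x‖ := by
  have := IsStarProjection.sq_norm_sub hP x
  exact le_of_sq_le_sq (by nlinarith [sq_nonneg ‖P x‖]) (norm_nonneg _)

theorem IsStarProjection.re_inner_self (hP : IsStarProjection P) (x : E) :
    (inner ℂ (P x) x).re = ‖P x‖ ^ 2 := by
  rw [← IsStarProjection.apply_apply hP, IsStarProjection.inner_apply hP]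
  have := inner_self_eq_norm_sq (𝕜 := ℂ) (P x)
  rw [IsStarProjection.apply_apply hP]
  exact this

theorem IsStarProjection.apply_eq_self_of_norm_le (hP : IsStarProjection P) {x : E}
    (h : ‖x‖ ≤ ‖P x‖) : P x = x := by
  have h1 := IsStarProjection.sq_norm_sub hP x
  have h2 : ‖x - P x‖ ^ 2 ≤ 0 := by nlinarith [norm_nonneg x]
  have h3 : ‖x - P x‖ = 0 := by nlinarith [norm_nonneg (x - P x)]
  exact (sub_eq_zero.1 (norm_eq_zero.1 h3)).symm

/-- The largest singular value of an operator that is not equal to `1`. -/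
def topSingular (T : E →L[ℂ] E) : ℝ :=
  sSup {x : ℝ | x ≠ 1 ∧ ∃ i, (T : E →ₗ[ℂ] E).singularValues i = x}

theorem finite_singularValues (T : E →ₗ[ℂ] E) :
    {x : ℝ | x ≠ 1 ∧ ∃ i, T.singularValues i = x}.Finite := by
  refine (T.singularValues.finite_range).subset ?_
  rintro x ⟨-, i, rfl⟩
  exact ⟨i, rfl⟩

theorem topSingular_nonneg (T : E →L[ℂ] E) : 0 ≤ topSingular T := by
  -- The sequence of singular values is zero beyond the dimension, so `0` always belongs to the set.
  refine le_csSup (finite_singularValues _).bddAbove ⟨zero_ne_one, Module.finrank ℂ E, ?_⟩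
  exact LinearMap.singularValues_of_finrank_le _ le_rfl

/-- Expand ‖T x‖² in an eigenbasis of T*T. The hypothesis makes x orthogonal to the eigenvectors for
singular value 1, so only the remaining singular values contribute. -/
theorem norm_apply_le_topSingular (T : E →L[ℂ] E) {x : E}
    (h : ∀ b, T.adjoint (T b) = b → inner ℂ b x = 0) :
    ‖T x‖ ≤ topSingular T * ‖x‖ := by
  have h0 := topSingular_nonneg T
  refine le_of_sq_le_sq ?_ (by positivity)
  set A : E →ₗ[ℂ] E := LinearMap.adjoint (T : E →ₗ[ℂ] E) ∘ₗ (T : E →ₗ[ℂ] E) with hA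
  have hsym : A.IsSymmetric := (T : E →ₗ[ℂ] E).isSymmetric_adjoint_comp_self
  have h1 : ‖T x‖ ^ 2 = (inner ℂ (A x) x).re := by
    rw [hA, LinearMap.comp_apply, LinearMap.adjoint_inner_left]
    exact (inner_self_eq_norm_sq (𝕜 := ℂ) (T x)).symm
  rw [h1, mul_pow]
  refine re_inner_le_mul_sq_norm hsym x _ fun i => ?_
  have h2 := (T : E →ₗ[ℂ] E).sq_singularValues_fin rfl i
  by_cases h3 : (T : E →ₗ[ℂ] E).singularValues i = 1
  · right
    apply h
    have h4 := hsym.apply_eigenvectorBasis rfl i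
    rw [← h2, h3] at h4
    simp only [hA] at h4
    exact h4.trans (by simp)
  · left
    rw [← h2]
    have : (T : E →ₗ[ℂ] E).singularValues i ≤ topSingular T :=
      le_csSup (finite_singularValues _).bddAbove ⟨h3, i, rfl⟩
    have := (T : E →ₗ[ℂ] E).singularValues_nonneg i
    gcongr

theorem topSingular_le_one (hP : IsStarProjection P) (hQ : IsStarProjection Q) :
    topSingular (P * Q) ≤ 1 := by
  refine Real.sSup_le ?_ zero_le_one
  rintro x ⟨-, i, rfl⟩
  set T : E →ₗ[ℂ] E := ((P * Q : E →L[ℂ] E) : E →ₗ[ℂ] E) with hT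
  rcases lt_or_ge i (Module.finrank ℂ E) with hi | hi
  · have h := T.hasEigenvalue_adjoint_comp_self_sq_singularValues hi
    obtain ⟨v, hv⟩ := h.exists_hasEigenvector
    have h1 : ‖T v‖ ^ 2 = (T.singularValues i) ^ 2 * ‖v‖ ^ 2 := by
      have e1 : ‖T v‖ ^ 2 = (inner ℂ ((LinearMap.adjoint T ∘ₗ T) v) v).re := by
        rw [LinearMap.comp_apply, LinearMap.adjoint_inner_left]
        exact (inner_self_eq_norm_sq (𝕜 := ℂ) (T v)).symm
      rw [e1, hv.apply_eq_smul, inner_smul_left, inner_self_eq_norm_sq_to_K]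
      simp [← Complex.ofReal_pow]
    have h2 : ‖T v‖ ≤ ‖v‖ := (IsStarProjection.norm_apply_le hP _).trans
      (IsStarProjection.norm_apply_le hQ _)
    have h3 : 0 < ‖v‖ := norm_pos_iff.2 hv.2
    have h4 : ‖T v‖ ^ 2 ≤ ‖v‖ ^ 2 := by gcongr
    rw [h1] at h4
    have h5 : (T.singularValues i) ^ 2 ≤ 1 := by
      by_contra! hc
      nlinarith [pow_pos h3 2]
    exact (sq_le_one_iff₀ (T.singularValues_nonneg i)).1 h5
  · rw [T.singularValues_of_finrank_le hi]; exact zero_le_one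

/-- The singular value 1 of PQ lives on U = ran P ∩ ran Q, and its contributions to Px and PQx
cancel. What is left of Qx is orthogonal to U, where PQ contracts by `topSingular`. This is how much
of ran P the factor 1 - Q can regenerate. -/
theorem norm_apply_sub_le (hP : IsStarProjection P) (hQ : IsStarProjection Q) (x : E) :
    ‖P (x - Q x)‖ ≤ ‖P x‖ + topSingular (P * Q) * ‖Q x‖ := by
  let U : Submodule ℂ E := LinearMap.ker ((1 - P : E →L[ℂ] E) : E →ₗ[ℂ] E) ⊓
    LinearMap.ker ((1 - Q : E →L[ℂ] E) : E →ₗ[ℂ] E)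
  have memU : ∀ {u}, u ∈ U ↔ P u = u ∧ Q u = u := by
    intro u
    simp [U, Submodule.mem_inf, sub_eq_zero, @eq_comm _ u]
  set R := U.starProjection with hRdef
  have hR : IsStarProjection R := isStarProjection_starProjection
  have hRU : ∀ y, R y ∈ U := fun y => U.starProjection_apply_mem y
  have hRP : ∀ y, R (P y) = R y := by
    intro y
    rw [eq_comm, ← sub_eq_zero, ← map_sub]
    rw [hRdef, Submodule.starProjection_apply_eq_zero_iff]
    rw [Submodule.mem_orthogonal]
    intro u hu
    rw [inner_sub_right, ← IsStarProjection.inner_apply hP, (memU.1 hu).1, sub_self]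
  have hRQ : ∀ y, R (Q y) = R y := by
    intro y
    rw [eq_comm, ← sub_eq_zero, ← map_sub]
    rw [hRdef, Submodule.starProjection_apply_eq_zero_iff]
    rw [Submodule.mem_orthogonal]
    intro u hu
    rw [inner_sub_right, ← IsStarProjection.inner_apply hQ, (memU.1 hu).2, sub_self]
  -- Both subtracted terms equal R x, since R absorbs P and Q and its range is fixed by both.
  have h1 : P (x - Q x) = (P x - R (P x)) - (P * Q) (Q x - R (Q x)) := by
    have := memU.1 (hRU x)
    simp [hRP, hRQ, this.1, this.2, IsStarProjection.apply_apply hQ]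
  rw [h1]
  refine (norm_sub_le _ _).trans (add_le_add (IsStarProjection.norm_sub_le hR _) ?_)
  refine (norm_apply_le_topSingular (P * Q) ?_).trans
    (mul_le_mul_of_nonneg_left (IsStarProjection.norm_sub_le hR _) (topSingular_nonneg _))
  intro b hb
  have hb' : Q (P (Q b)) = b := by
    have e : (P * Q).adjoint = Q * P := by
      rw [← ContinuousLinearMap.star_eq_adjoint, star_mul, hP.isSelfAdjoint.star_eq,
        hQ.isSelfAdjoint.star_eq]
    rw [e] at hb
    simpa [IsStarProjection.apply_apply hP] using hb
  have hQb : Q b = b := by rw [← hb', IsStarProjection.apply_apply hQ]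
  -- From QPb = b, ‖b‖ ≤ ‖Pb‖, and a projector that does not shorten a vector fixes it.
  have hPb : P b = b := by
    refine IsStarProjection.apply_eq_self_of_norm_le hP ?_
    rw [hQb] at hb'
    conv_lhs => rw [← hb']
    exact IsStarProjection.norm_apply_le hQ _
  have hb2 : b ∈ U := memU.2 ⟨hPb, hQb⟩
  exact (Submodule.mem_orthogonal U _).1 (U.sub_starProjection_mem_orthogonal _) b hb2

/-- If the only singular values of `P * Q` are `0` and `1`, then `P` and `Q` commute. -/
theorem commute_of_topSingular_eq_zero (hP : IsStarProjection P) (hQ : IsStarProjection Q)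
    (h : topSingular (P * Q) = 0) : Commute P Q := by
  -- On x - P x the bound of `norm_apply_sub_le` vanishes, so PQ(1 - P) = 0; taking adjoints then
  -- gives commutation.
  have key : P * Q = P * Q * P := by
    ext x
    have := norm_apply_sub_le hP hQ (x - P x)
    rw [h, map_sub P x, IsStarProjection.apply_apply hP, sub_self, norm_zero, zero_mul,
      add_zero, norm_le_zero_iff] at this
    rw [map_sub P, map_sub P x, IsStarProjection.apply_apply hP, sub_self, zero_sub, neg_eq_zero,
      map_sub Q, map_sub P, sub_eq_zero] at this
    exact this
  have := congr(star $key)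
  simp only [star_mul, hP.isSelfAdjoint.star_eq, hQ.isSelfAdjoint.star_eq] at this
  change P * Q = Q * P
  rw [key, this, mul_assoc]

end Abstract

/-! ### Detectability estimates and quantum union bounds -/

section Detectability

variable {E : Type*} [NormedAddCommGroup E] [InnerProductSpace ℂ E] [FiniteDimensional ℂ E]

open Classical in
/-- For `φ = ∏ (1 - Pᵢ) ψ`, the product over a list without repetitions, each `‖Pᵢ φ‖` is
bounded by the norms `D j` of the components removed by the factors that do not commute
with `Pᵢ`. -/
theorem exists_removed_norms {ι : Type*} {P : ι → E →L[ℂ] E} {s : ℝ} (hs : 0 ≤ s) (ψ : E)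
    (L : List ι) (hnd : L.Nodup) (hP : ∀ i ∈ L, IsStarProjection (P i))
    (hPs : ∀ i ∈ L, ∀ j ∈ L, i ≠ j → ∀ x, ‖P i (x - P j x)‖ ≤ ‖P i x‖ + s * ‖P j x‖) :
    ∃ D : ι → ℝ, (∀ j, 0 ≤ D j) ∧
      ∑ j ∈ L.toFinset, D j ^ 2 = ‖ψ‖ ^ 2 - ‖(L.map fun i => 1 - P i).prod ψ‖ ^ 2 ∧
      ∀ i ∈ L, ‖P i ((L.map fun i => 1 - P i).prod ψ)‖ ≤
        s * ∑ j ∈ L.toFinset with j ≠ i ∧ ¬ Commute (P i) (P j), D j := by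
  induction L with
  | nil => exact ⟨0, by simp⟩
  | cons a L ih =>
    rw [List.nodup_cons] at hnd
    obtain ⟨D, hD0, hD1, hD2⟩ := ih hnd.2 (fun i hi => hP i (List.mem_cons_of_mem _ hi))
      (fun i hi j hj => hPs i (List.mem_cons_of_mem _ hi) j (List.mem_cons_of_mem _ hj))
    have ha := hP a List.mem_cons_self
    have haL : a ∉ L.toFinset := by simpa using hnd.1
    set φ := (L.map fun i => 1 - P i).prod ψ with hφ
    have hcons : ((a :: L).map fun i => 1 - P i).prod ψ = φ - P a φ := by
      simp [hφ]
    rw [hcons]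
    have hD' : ∀ j ∈ L.toFinset, Function.update D a ‖P a φ‖ j = D j := fun j hj =>
      Function.update_of_ne (by rintro rfl; exact haL hj) _ _
    -- The head of the list is the factor applied last; it removes the component `P a φ`.
    refine ⟨Function.update D a ‖P a φ‖, fun j => ?_, ?_, fun i hi => ?_⟩
    · by_cases h : j = a
      · subst h; simp
      · simpa [h] using hD0 j
    · rw [List.toFinset_cons, Finset.sum_insert haL, Function.update_self,
        Finset.sum_congr rfl fun j hj => by rw [hD' j hj], hD1, IsStarProjection.sq_norm_sub ha]
      ring
    · rcases List.mem_cons.1 hi with rfl | hiL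
      · rw [map_sub, IsStarProjection.apply_apply ha, sub_self, norm_zero]
        refine mul_nonneg hs (Finset.sum_nonneg fun j _ => ?_)
        by_cases h : j = i
        · subst h; simp
        · simpa [h] using hD0 j
      · have hia : i ≠ a := fun h => hnd.1 (h ▸ hiL)
        have hsum : ∑ j ∈ L.toFinset with j ≠ i ∧ ¬ Commute (P i) (P j),
            Function.update D a ‖P a φ‖ j =
            ∑ j ∈ L.toFinset with j ≠ i ∧ ¬ Commute (P i) (P j), D j :=
          Finset.sum_congr rfl fun j hj => hD' j (Finset.mem_filter.1 hj).1
        rw [List.toFinset_cons, Finset.filter_insert]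
        by_cases hc : Commute (P i) (P a)
        · rw [if_neg (by simp [hc]), hsum]
          refine le_trans ?_ (hD2 i hiL)
          -- A commuting factor acts on `P i φ` as the contraction 1 - P a.
          have e : P i (P a φ) = P a (P i φ) := congr($(hc.eq) φ)
          rw [map_sub, e]
          exact IsStarProjection.norm_sub_le ha _
        · rw [if_pos ⟨hia.symm, hc⟩, Finset.sum_insert (by simp [hnd.1]), hsum,
            Function.update_self, mul_add, add_comm]
          exact (hPs i hi a List.mem_cons_self hia φ).trans
            (add_le_add_left (hD2 i hiL) _)

open Classical in
-- One factor g comes from Cauchy-Schwarz over the at most g removed components in each bound, the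
-- other from double counting: by symmetry of commutation each D j occurs in at most g of the
-- bounds.
theorem sum_sq_norm_apply_prod_le {ι : Type*} {P : ι → E →L[ℂ] E} {s : ℝ} (hs : 0 ≤ s) (ψ : E)
    (L : List ι) (hnd : L.Nodup) (hP : ∀ i ∈ L, IsStarProjection (P i))
    (hPs : ∀ i ∈ L, ∀ j ∈ L, i ≠ j → ∀ x, ‖P i (x - P j x)‖ ≤ ‖P i x‖ + s * ‖P j x‖) (g : ℕ)
    (S : Finset ι) (hS : ∀ i, i ∈ L ↔ i ∈ S)
    (hg : ∀ i ∈ S, (S.filter fun j => j ≠ i ∧ ¬ Commute (P i) (P j)).card ≤ g) :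
    ∑ i ∈ S, ‖P i ((L.map fun i => 1 - P i).prod ψ)‖ ^ 2 ≤
      s ^ 2 * g ^ 2 * (‖ψ‖ ^ 2 - ‖(L.map fun i => 1 - P i).prod ψ‖ ^ 2) := by
  obtain rfl : L.toFinset = S := by ext; simp [hS]
  obtain ⟨D, hD0, hD1, hD2⟩ := exists_removed_norms hs ψ L hnd hP hPs
  rw [← hD1]
  have step : ∀ i ∈ L.toFinset, ‖P i ((L.map fun i => 1 - P i).prod ψ)‖ ^ 2 ≤
      s ^ 2 * (g * ∑ j ∈ L.toFinset with j ≠ i ∧ ¬ Commute (P i) (P j), D j ^ 2) := by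
    intro i hi
    have hi' := List.mem_toFinset.1 hi
    calc _ ≤ (s * ∑ j ∈ L.toFinset with j ≠ i ∧ ¬ Commute (P i) (P j), D j) ^ 2 := by
          gcongr; exact hD2 i hi'
      _ = s ^ 2 * (∑ j ∈ L.toFinset with j ≠ i ∧ ¬ Commute (P i) (P j), D j) ^ 2 := by ring
      _ ≤ _ := by
          gcongr
          refine (sq_sum_le_card_mul_sum_sq).trans ?_
          have := hg i hi
          have h0 : 0 ≤ ∑ j ∈ L.toFinset with j ≠ i ∧ ¬ Commute (P i) (P j), D j ^ 2 :=
            Finset.sum_nonneg fun _ _ => sq_nonneg _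
          gcongr
  refine (Finset.sum_le_sum step).trans ?_
  rw [← Finset.mul_sum, ← Finset.mul_sum, mul_assoc, pow_two (g : ℝ), mul_assoc]
  gcongr
  simp_rw [Finset.sum_filter]
  rw [Finset.sum_comm, Finset.mul_sum]
  refine Finset.sum_le_sum fun j hj => ?_
  rw [← Finset.sum_filter, Finset.sum_const, nsmul_eq_mul]
  gcongr
  refine le_trans (Finset.card_le_card ?_) (hg j hj)
  intro i
  simp only [Finset.mem_filter]
  exact fun ⟨h1, h2, h3⟩ => ⟨h1, h2.symm, fun h => h3 h.symm⟩

/-- **Quantum union bound** for a sequence of projective measurements. -/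
theorem re_inner_sub_prod_le (L : List (E →L[ℂ] E)) (hL : ∀ Q ∈ L, IsStarProjection Q) (y : E) :
    ‖L.prod y‖ ≤ ‖y‖ ∧ (inner ℂ y (y - L.prod y)).re ≤
      √((L.map fun Q => ‖y - Q y‖ ^ 2).sum) * √(‖y‖ ^ 2 - ‖L.prod y‖ ^ 2) := by
  induction L with
  | nil => simp
  | cons Q L ih =>
    obtain ⟨ih1, ih2⟩ := ih fun Q hQ => hL Q (List.mem_cons_of_mem _ hQ)
    have hQ := hL Q List.mem_cons_self
    have e : (Q :: L).prod y = Q (L.prod y) := by simp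
    rw [e, List.map_cons, List.sum_cons]
    set φ := L.prod y
    set S := (L.map fun Q => ‖y - Q y‖ ^ 2).sum with hS
    have hS0 : 0 ≤ S := by
      refine List.sum_nonneg fun x hx => ?_
      obtain ⟨_, _, rfl⟩ := List.mem_map.1 hx
      positivity
    refine ⟨(IsStarProjection.norm_apply_le hQ _).trans ih1, ?_⟩
    -- The vector φ - Qφ lies in the range of 1 - Q, so y may be replaced by y - Qy.
    have h1 : (inner ℂ y (φ - Q φ)).re ≤ ‖y - Q y‖ * ‖φ - Q φ‖ := by
      have : inner ℂ y (φ - Q φ) = inner ℂ (y - Q y) (φ - Q φ) := by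
        rw [inner_sub_left, IsStarProjection.inner_apply hQ, map_sub,
          IsStarProjection.apply_apply hQ, sub_self, inner_zero_right, sub_zero]
      rw [this]
      exact re_inner_le_norm (𝕜 := ℂ) _ _
    have h2 : y - Q φ = (y - φ) + (φ - Q φ) := by abel
    rw [h2, inner_add_right, Complex.add_re]
    refine (add_le_add ih2 h1).trans ?_
    have h3 : ‖y‖ ^ 2 - ‖Q φ‖ ^ 2 = (‖y‖ ^ 2 - ‖φ‖ ^ 2) + ‖φ - Q φ‖ ^ 2 := by
      rw [IsStarProjection.sq_norm_sub hQ]; ring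
    have hB : 0 ≤ ‖y‖ ^ 2 - ‖φ‖ ^ 2 := by
      have : ‖φ‖ ^ 2 ≤ ‖y‖ ^ 2 := by gcongr
      linarith
    rw [h3, ← Real.sqrt_mul (x := _ + S) (by positivity)]
    -- Cauchy-Schwarz in the plane for (√S, ‖y - Qy‖) and (√B, ‖φ - Qφ‖).
    apply Real.le_sqrt_of_sq_le
    set B := ‖y‖ ^ 2 - ‖φ‖ ^ 2
    have hSs := Real.sq_sqrt hS0
    have hBs := Real.sq_sqrt hB
    rw [← hSs, ← hBs, Real.sqrt_sq (Real.sqrt_nonneg _), Real.sqrt_sq (Real.sqrt_nonneg _)]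
    nlinarith [sq_nonneg (√S * ‖φ - Q φ‖ - √B * ‖y - Q y‖)]

/-- With φ the image of y, the union bound gives ‖y‖(‖y‖ - ‖φ‖) ≤ √S √(‖y‖² - ‖φ‖²). Squaring and
cancelling ‖y‖ - ‖φ‖ leaves S ≥ ‖y‖²(‖y‖ - ‖φ‖)/(‖y‖ + ‖φ‖), which decreases in ‖φ‖ ≤ c‖y‖. Used for
m ≥ 3. -/
theorem mul_sq_norm_le_sum_of_norm_prod_le (L : List (E →L[ℂ] E))
    (hL : ∀ Q ∈ L, IsStarProjection Q) (y : E) {c : ℝ} (hc0 : 0 ≤ c) (hc1 : c < 1)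
    (h : ‖L.prod y‖ ≤ c * ‖y‖) :
    (1 - c) / (1 + c) * ‖y‖ ^ 2 ≤ (L.map fun Q => ‖y - Q y‖ ^ 2).sum := by
  obtain ⟨h1, h2⟩ := re_inner_sub_prod_le L hL y
  set φ := L.prod y
  set S := (L.map fun Q => ‖y - Q y‖ ^ 2).sum with hS
  have hS0 : 0 ≤ S := by
    refine List.sum_nonneg fun x hx => ?_
    obtain ⟨_, _, rfl⟩ := List.mem_map.1 hx
    positivity
  have hB : 0 ≤ ‖y‖ ^ 2 - ‖φ‖ ^ 2 := by
    have : ‖φ‖ ^ 2 ≤ ‖y‖ ^ 2 := by gcongr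
    linarith
  have h3 : ‖y‖ ^ 2 - ‖y‖ * ‖φ‖ ≤ (inner ℂ y (y - φ)).re := by
    have e1 : (inner ℂ y y).re = ‖y‖ ^ 2 := inner_self_eq_norm_sq (𝕜 := ℂ) y
    have e2 : (inner ℂ y φ).re ≤ ‖y‖ * ‖φ‖ := re_inner_le_norm (𝕜 := ℂ) _ _
    rw [inner_sub_right, Complex.sub_re, e1]
    linarith
  have hq0 := norm_nonneg φ
  have hy0 := norm_nonneg y
  rcases hy0.eq_or_lt with hy | hy
  · rw [← hy]; simpa using hS0
  have h4 : (‖y‖ * (‖y‖ - ‖φ‖)) ^ 2 ≤ S * (‖y‖ ^ 2 - ‖φ‖ ^ 2) := by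
    rw [← Real.sq_sqrt hS0, ← Real.sq_sqrt hB, ← mul_pow]
    have : 0 ≤ ‖y‖ * (‖y‖ - ‖φ‖) := mul_nonneg hy0 (by linarith)
    exact pow_le_pow_left₀ this (by linarith) 2
  have hlt : 0 < ‖y‖ - ‖φ‖ := by nlinarith
  have h5 : ‖y‖ ^ 2 * (‖y‖ - ‖φ‖) ≤ S * (‖y‖ + ‖φ‖) := by
    refine le_of_mul_le_mul_right ?_ hlt
    nlinarith
  have h6 : ‖y‖ ^ 2 * (‖y‖ - c * ‖y‖) ≤ S * (‖y‖ + c * ‖y‖) := by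
    have a1 : ‖y‖ ^ 2 * (‖y‖ - c * ‖y‖) ≤ ‖y‖ ^ 2 * (‖y‖ - ‖φ‖) := by gcongr
    have a2 : S * (‖y‖ + ‖φ‖) ≤ S * (‖y‖ + c * ‖y‖) := by gcongr
    linarith
  have h7 : ‖y‖ ^ 2 * (1 - c) ≤ S * (1 + c) := by
    refine le_of_mul_le_mul_right ?_ hy
    linarith
  rw [div_mul_eq_mul_div, div_le_iff₀ (by linarith)]
  linarith

/-- The overlap of Qy and Ry is at most c‖Qy‖‖Ry‖, so ‖Qy + Ry‖² ≤ (1 + c)(‖Qy‖² + ‖Ry‖²), while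
‖Qy‖² + ‖Ry‖² = Re⟨Qy + Ry, y⟩. Hence ‖Qy‖² + ‖Ry‖² ≤ (1 + c)‖y‖². The hypothesis is the contraction
of QR at the vector Ry. Used for m = 2. -/
theorem mul_sq_norm_le_add_of_norm_mul_le {Q R : E →L[ℂ] E}
    (hQ : IsStarProjection Q) (hR : IsStarProjection R) (y : E) {c : ℝ} (hc0 : 0 ≤ c)
    (h : ‖Q (R (R y))‖ ≤ c * ‖R y‖) :
    (1 - c) * ‖y‖ ^ 2 ≤ ‖y - Q y‖ ^ 2 + ‖y - R y‖ ^ 2 := by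
  rw [IsStarProjection.sq_norm_sub hQ, IsStarProjection.sq_norm_sub hR]
  have h1 : ‖Q y‖ ^ 2 + ‖R y‖ ^ 2 ≤ ‖y‖ * ‖Q y + R y‖ := by
    rw [← IsStarProjection.re_inner_self hQ, ← IsStarProjection.re_inner_self hR,
      ← Complex.add_re, ← inner_add_left, mul_comm]
    exact re_inner_le_norm (𝕜 := ℂ) _ _
  have h2 : ‖Q y + R y‖ ^ 2 ≤ (1 + c) * (‖Q y‖ ^ 2 + ‖R y‖ ^ 2) := by
    have e : (inner ℂ (Q y) (R y)).re ≤ ‖Q y‖ * (c * ‖R y‖) := by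
      have e0 : inner ℂ (Q y) (R y) = inner ℂ (Q y) (Q (R (R y))) := by
        rw [← IsStarProjection.inner_apply hQ, IsStarProjection.apply_apply hQ,
          IsStarProjection.apply_apply hR]
      rw [e0]
      exact (re_inner_le_norm (𝕜 := ℂ) _ _).trans
        (mul_le_mul_of_nonneg_left h (norm_nonneg _))
    have e2 := norm_add_sq (𝕜 := ℂ) (Q y) (R y)
    simp only [RCLike.re_eq_complex_re] at e2
    rw [e2]
    nlinarith [mul_nonneg hc0 (sq_nonneg (‖Q y‖ - ‖R y‖))]
  have h0 : 0 ≤ ‖Q y‖ ^ 2 + ‖R y‖ ^ 2 := by positivity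
  suffices ‖Q y‖ ^ 2 + ‖R y‖ ^ 2 ≤ (1 + c) * ‖y‖ ^ 2 by linarith
  rcases h0.eq_or_lt with h0 | h0
  · rw [← h0]; positivity
  refine le_of_mul_le_mul_right ?_ h0
  calc _ = (‖Q y‖ ^ 2 + ‖R y‖ ^ 2) ^ 2 := by ring
    _ ≤ (‖y‖ * ‖Q y + R y‖) ^ 2 := by gcongr
    _ = ‖y‖ ^ 2 * ‖Q y + R y‖ ^ 2 := by ring
    _ ≤ ‖y‖ ^ 2 * ((1 + c) * (‖Q y‖ ^ 2 + ‖R y‖ ^ 2)) := by gcongr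
    _ = _ := by ring

end Detectability

/-! ### Operator inequalities for verification operators and their products -/

section Order

variable {E : Type*} [NormedAddCommGroup E] [InnerProductSpace ℂ E] [FiniteDimensional ℂ E]

theorem le_of_re_inner_le {S T : E →L[ℂ] E} (hS : IsSelfAdjoint S) (hT : IsSelfAdjoint T)
    (h : ∀ x, (inner ℂ (S x) x).re ≤ (inner ℂ (T x) x).re) : S ≤ T := by
  rw [ContinuousLinearMap.le_def, ContinuousLinearMap.isPositive_def']
  refine ⟨hT.sub hS, fun x => ?_⟩
  rw [ContinuousLinearMap.reApplyInnerSelf_apply, sub_apply, inner_sub_left]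
  simpa using h x

omit [FiniteDimensional ℂ E] in
theorem re_inner_mono {S T : E →L[ℂ] E} (h : S ≤ T) (x : E) :
    (inner ℂ (S x) x).re ≤ (inner ℂ (T x) x).re := by
  have := (ContinuousLinearMap.le_def _ _).1 h |>.re_inner_nonneg_left x
  rw [sub_apply, inner_sub_left] at this
  simpa using this

omit [FiniteDimensional ℂ E] in
theorem re_inner_nonneg {T : E →L[ℂ] E} (h : 0 ≤ T) (x : E) : 0 ≤ (inner ℂ (T x) x).re := by
  simpa using re_inner_mono h x

omit [FiniteDimensional ℂ E] in
theorem smul_nonneg_of_nonneg {T : E →L[ℂ] E} (h : 0 ≤ T) {r : ℝ} (hr : 0 ≤ r) :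
    0 ≤ (r : ℂ) • T := by
  rw [ContinuousLinearMap.nonneg_iff_isPositive] at h ⊢
  exact h.smul_of_nonneg (by exact_mod_cast hr)

theorem norm_le_of_re_inner_le {T : E →L[ℂ] E} (hT : 0 ≤ T) {r : ℝ} (hr : 0 ≤ r)
    (h : ∀ x, (inner ℂ (T x) x).re ≤ r * ‖x‖ ^ 2) : ‖T‖ ≤ r := by
  rw [CStarAlgebra.norm_le_iff_le_algebraMap T hr hT]
  refine le_of_re_inner_le (IsSelfAdjoint.of_nonneg hT) ?_ fun x => ?_
  · exact IsSelfAdjoint.algebraMap _ (IsSelfAdjoint.all r)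
  · refine (h x).trans (le_of_eq ?_)
    rw [Algebra.algebraMap_eq_smul_one, ← Complex.coe_smul, smul_apply, one_apply_eq_self,
      inner_smul_left, inner_self_eq_norm_sq_to_K]
    simp [← Complex.ofReal_pow]

omit [FiniteDimensional ℂ E] in
theorem re_inner_le_norm_mul (T : E →L[ℂ] E) (x : E) :
    (inner ℂ (T x) x).re ≤ ‖T‖ * ‖x‖ ^ 2 := by
  refine (re_inner_le_norm (𝕜 := ℂ) _ _).trans ?_
  rw [pow_two, ← mul_assoc]
  gcongr
  exact T.le_opNorm x

open Module in
theorem exists_apply_eq_norm_smul [Nontrivial E] {T : E →L[ℂ] E} (hT : 0 ≤ T) :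
    ∃ v : E, v ≠ 0 ∧ T v = (‖T‖ : ℂ) • v := by
  have hsym : (T : E →ₗ[ℂ] E).IsSymmetric := (IsSelfAdjoint.of_nonneg hT).isSymmetric
  have : Nonempty (Fin (finrank ℂ E)) := ⟨⟨0, finrank_pos⟩⟩
  obtain ⟨i, hi⟩ := Finite.exists_max (hsym.eigenvalues (n := finrank ℂ E) rfl)
  have hv := hsym.hasEigenvector_eigenvectorBasis rfl i
  have hTv : T (hsym.eigenvectorBasis rfl i) = _ := hv.apply_eq_smul
  refine ⟨_, hv.2, ?_⟩
  have h0 : 0 ≤ hsym.eigenvalues rfl i := by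
    have := re_inner_nonneg hT (hsym.eigenvectorBasis rfl i)
    rw [hTv, inner_smul_left, inner_self_eq_norm_sq_to_K] at this
    simpa using this
  have e : hsym.eigenvalues rfl i = ‖T‖ := by
    refine le_antisymm ?_ (norm_le_of_re_inner_le hT h0 fun x =>
      re_inner_le_mul_sq_norm hsym x _ fun j => Or.inl (hi j))
    have := T.le_opNorm (hsym.eigenvectorBasis rfl i)
    rw [hTv, norm_smul] at this
    simpa [abs_of_nonneg h0] using this
  rw [hTv, ← e]
  rfl

/-- Ω - Q vanishes on the range of Q, so its quadratic form sees only (1 - Q)x. -/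
theorem sub_le_norm_smul {Q Ω : E →L[ℂ] E} (hQ : IsStarProjection Q) (h : Q ≤ Ω)
    (hΩ : Ω * Q = Q) : Ω - Q ≤ (‖Ω - Q‖ : ℂ) • (1 - Q) := by
  have hX : 0 ≤ Ω - Q := sub_nonneg.2 h
  have hXs := IsSelfAdjoint.of_nonneg hX
  have hXQ : ∀ x, (Ω - Q) (Q x) = 0 := fun x => by
    have : (Ω - Q) * Q = 0 := by rw [sub_mul, hΩ, hQ.isIdempotentElem.eq, sub_self]
    exact congr($this x)
  refine le_of_re_inner_le hXs ?_ fun x => ?_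
  · refine IsSelfAdjoint.smul ?_ hQ.one_sub.isSelfAdjoint
    simp [IsSelfAdjoint]
  · have e1 : inner ℂ ((Ω - Q) x) x = inner ℂ ((Ω - Q) (x - Q x)) (x - Q x) := by
      rw [map_sub (Ω - Q), hXQ, sub_zero, inner_sub_right,
        hXs.isSymmetric.apply_clm x (Q x), hXQ, inner_zero_right, sub_zero]
    rw [e1]
    refine (re_inner_le_norm_mul _ _).trans (le_of_eq ?_)
    have := IsStarProjection.re_inner_self hQ.one_sub x
    rw [smul_apply, inner_smul_left]
    simp only [Complex.conj_ofReal, Complex.re_ofReal_mul, this]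
    rfl

theorem le_one_sub_smul {Q Ω : E →L[ℂ] E} (hQ : IsStarProjection Q) (h : Q ≤ Ω)
    (hΩ : Ω * Q = Q) {ν : ℝ} (hν : ν ≤ 1 - ‖Ω - Q‖) : Ω ≤ 1 - (ν : ℂ) • (1 - Q) := by
  have h1 := sub_le_norm_smul hQ h hΩ
  have h2 := smul_nonneg_of_nonneg
    ((ContinuousLinearMap.nonneg_iff_isPositive _).2 (.of_isStarProjection hQ.one_sub))
    (sub_nonneg.2 hν)
  rw [← sub_nonneg] at h1 ⊢
  have := add_nonneg h1 h2
  refine this.trans (le_of_eq ?_)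
  push_cast
  module

theorem telescope_one_sub_smul {A : Type*} [Ring A] [Algebra ℂ A] (ν : ℂ) (a t q r : A) :
    a * ((1 - ν • (1 - r)) - t) + ((1 - ν • (1 - q)) - a) * (1 - ν • (1 - r)) +
      (ν * (1 - ν)) • ((1 - q) * (1 - r)) = 1 - ν • (1 - q * r) - a * t := by
  simp only [mul_sub, sub_mul, mul_one, one_mul, smul_mul_assoc, mul_smul_comm, smul_sub,
    smul_smul]
  module

theorem commute_one_sub_smul {A : Type*} [Ring A] [Algebra ℂ A] (ν : ℂ) {x y : A}
    (h : Commute x y) : Commute x (1 - ν • (1 - y)) :=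
  (Commute.one_right x).sub_right (((Commute.one_right x).sub_right h).smul_right ν)

/-- By `telescope_one_sub_smul` the difference of the two sides is a sum of three terms, each a
nonnegative multiple of a product of two commuting positive operators. -/
theorem mul_le_one_sub_smul {a t q r : E →L[ℂ] E} {ν : ℝ} (hν0 : 0 ≤ ν) (hν1 : ν ≤ 1)
    (hq : IsStarProjection q) (hr : IsStarProjection r) (ha : 0 ≤ a) (ht : 0 ≤ t)
    (haq : a ≤ 1 - (ν : ℂ) • (1 - q)) (htr : t ≤ 1 - (ν : ℂ) • (1 - r))
    (cat : Commute a t) (car : Commute a r) (cqr : Commute q r) :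
    a * t ≤ 1 - (ν : ℂ) • (1 - q * r) := by
  have c1 := commute_one_sub_smul (ν : ℂ) car
  have c2 : Commute (1 - (ν : ℂ) • (1 - q)) (1 - (ν : ℂ) • (1 - r)) :=
    commute_one_sub_smul _ (commute_one_sub_smul _ cqr.symm).symm
  have h1 : 0 ≤ a * ((1 - (ν : ℂ) • (1 - r)) - t) :=
    Commute.mul_nonneg ha (sub_nonneg.2 htr) (c1.sub_right cat)
  have h2 : 0 ≤ ((1 - (ν : ℂ) • (1 - q)) - a) * (1 - (ν : ℂ) • (1 - r)) :=
    Commute.mul_nonneg (sub_nonneg.2 haq) (ht.trans htr) (c2.sub_left c1)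
  have h3 : 0 ≤ ((ν * (1 - ν) : ℝ) : ℂ) • ((1 - q) * (1 - r)) := by
    refine smul_nonneg_of_nonneg (Commute.mul_nonneg
      ((ContinuousLinearMap.nonneg_iff_isPositive _).2 (.of_isStarProjection hq.one_sub))
      ((ContinuousLinearMap.nonneg_iff_isPositive _).2 (.of_isStarProjection hr.one_sub)) ?_)
      (mul_nonneg hν0 (sub_nonneg.2 hν1))
    exact (Commute.one_right _).sub_right ((Commute.one_left _).sub_left cqr)
  rw [← sub_nonneg]
  refine (add_nonneg (add_nonneg h1 h2) h3).trans (le_of_eq ?_)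
  push_cast
  exact telescope_one_sub_smul _ _ _ _ _

/-- `∏ Ωᵢ ≤ 1 - ν (1 - ∏ Qᵢ)` for commuting families with `0 ≤ Ωᵢ ≤ 1 - ν (1 - Qᵢ)`, where
the product of the `Qᵢ` may be restricted to a sublist. -/
theorem list_prod_le_one_sub_smul {ι : Type*} {Ω Q : ι → E →L[ℂ] E} {ν : ℝ} (hν0 : 0 ≤ ν)
    (hν1 : ν ≤ 1) (p : ι → Bool) (L : List ι) (hnd : L.Nodup)
    (hQ : ∀ i ∈ L, IsStarProjection (Q i)) (hΩ0 : ∀ i ∈ L, 0 ≤ Ω i) (hΩ1 : ∀ i ∈ L, Ω i ≤ 1)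
    (hΩQ : ∀ i ∈ L, Ω i ≤ 1 - (ν : ℂ) • (1 - Q i))
    (hc1 : ∀ i ∈ L, ∀ j ∈ L, i ≠ j → Commute (Ω i) (Ω j))
    (hc2 : ∀ i ∈ L, ∀ j ∈ L, i ≠ j → Commute (Ω i) (Q j))
    (hc3 : ∀ i ∈ L, ∀ j ∈ L, i ≠ j → Commute (Q i) (Q j)) :
    0 ≤ (L.map Ω).prod ∧ IsStarProjection ((L.filter p).map Q).prod ∧
      (L.map Ω).prod ≤ 1 - (ν : ℂ) • (1 - ((L.filter p).map Q).prod) := by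
  induction L with
  | nil => exact ⟨by simp, by simp, by simp⟩
  | cons a L ih =>
    rw [List.nodup_cons] at hnd
    obtain ⟨ih1, ih2, ih3⟩ := ih hnd.2 (fun i hi => hQ i (List.mem_cons_of_mem _ hi))
      (fun i hi => hΩ0 i (List.mem_cons_of_mem _ hi))
      (fun i hi => hΩ1 i (List.mem_cons_of_mem _ hi))
      (fun i hi => hΩQ i (List.mem_cons_of_mem _ hi))
      (fun i hi j hj => hc1 i (List.mem_cons_of_mem _ hi) j (List.mem_cons_of_mem _ hj))
      (fun i hi j hj => hc2 i (List.mem_cons_of_mem _ hi) j (List.mem_cons_of_mem _ hj))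
      (fun i hi j hj => hc3 i (List.mem_cons_of_mem _ hi) j (List.mem_cons_of_mem _ hj))
    have ha := List.mem_cons_self (a := a) (l := L)
    have hne : ∀ j ∈ L, a ≠ j := by rintro j hj rfl; exact hnd.1 hj
    have cΩT : Commute (Ω a) (L.map Ω).prod := by
      refine Commute.list_prod_right _ _ fun x hx => ?_
      obtain ⟨j, hj, rfl⟩ := List.mem_map.1 hx
      exact hc1 a ha j (List.mem_cons_of_mem _ hj) (hne j hj)
    have cΩR : Commute (Ω a) ((L.filter p).map Q).prod := by
      refine Commute.list_prod_right _ _ fun x hx => ?_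
      obtain ⟨j, hj, rfl⟩ := List.mem_map.1 hx
      exact hc2 a ha j (List.mem_cons_of_mem _ (List.mem_filter.1 hj).1)
        (hne j (List.mem_filter.1 hj).1)
    have cQR : Commute (Q a) ((L.filter p).map Q).prod := by
      refine Commute.list_prod_right _ _ fun x hx => ?_
      obtain ⟨j, hj, rfl⟩ := List.mem_map.1 hx
      exact hc3 a ha j (List.mem_cons_of_mem _ (List.mem_filter.1 hj).1)
        (hne j (List.mem_filter.1 hj).1)
    set T := (L.map Ω).prod with hT
    set R := ((L.filter p).map Q).prod with hR
    have hTnn : 0 ≤ Ω a * T := Commute.mul_nonneg (hΩ0 a ha) ih1 cΩT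
    rw [List.map_cons, List.prod_cons]
    by_cases hp : p a
    · rw [List.filter_cons_of_pos hp, List.map_cons, List.prod_cons, ← hT, ← hR]
      refine ⟨hTnn, (hQ a ha).mul ih2 cQR, ?_⟩
      exact mul_le_one_sub_smul hν0 hν1 (hQ a ha) ih2 (hΩ0 a ha) ih1 (hΩQ a ha) ih3 cΩT cΩR
        cQR
    -- A factor left out of the product of the Q's is bounded simply by 1.
    · rw [List.filter_cons_of_neg hp, ← hT, ← hR]
      refine ⟨hTnn, ih2, le_trans ?_ ih3⟩
      rw [← sub_nonneg]
      have := Commute.mul_nonneg (sub_nonneg.2 (hΩ1 a ha)) ih1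
        ((Commute.one_left _).sub_left cΩT)
      simpa [sub_mul] using this

/-- A self-adjoint operator fixing K pointwise is block diagonal, so Ω - Q = (1 - Q)Ω(1 - Q) ≥ 0 for
Q the projector onto K. -/
theorem starProjection_le {K : Submodule ℂ E} {Ω : E →L[ℂ] E} (hΩ : 0 ≤ Ω)
    (hΩK : ∀ x ∈ K, Ω x = x) : K.starProjection ≤ Ω ∧ Ω * K.starProjection = K.starProjection := by
  have h : Ω * K.starProjection = K.starProjection := by
    ext x : 1
    exact hΩK _ (K.starProjection_apply_mem x)
  have hK : IsStarProjection K.starProjection := isStarProjection_starProjection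
  have h' : K.starProjection * Ω = K.starProjection := by
    have := congr(star $h)
    rwa [star_mul, hK.isSelfAdjoint.star_eq, (IsSelfAdjoint.of_nonneg hΩ).star_eq] at this
  refine ⟨?_, h⟩
  rw [← sub_nonneg]
  refine (hK.one_sub.isSelfAdjoint.conjugate_nonneg hΩ).trans (le_of_eq ?_)
  rw [sub_mul, one_mul, h', mul_sub, mul_one, sub_mul, h, hK.isIdempotentElem.eq]
  abel

/-- To bound `‖Ω - Q₀‖` it suffices to bound the quadratic form of `Ω` on the orthogonal
complement of the range of `Q₀`. -/
theorem norm_sub_starProjection_le {K : Submodule ℂ E} {Ω : E →L[ℂ] E} (hΩ : 0 ≤ Ω)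
    (hΩK : ∀ x ∈ K, Ω x = x) {r : ℝ} (hr : 0 ≤ r)
    (h : ∀ y ∈ Kᗮ, (inner ℂ (Ω y) y).re ≤ r * ‖y‖ ^ 2) : ‖Ω - K.starProjection‖ ≤ r := by
  obtain ⟨hle, hmul⟩ := starProjection_le hΩ hΩK
  have hK : IsStarProjection K.starProjection := isStarProjection_starProjection
  have hX := sub_nonneg.2 hle
  refine norm_le_of_re_inner_le hX hr fun x => ?_
  have hXQ : ∀ x, (Ω - K.starProjection) (K.starProjection x) = 0 := fun x => by
    have : (Ω - K.starProjection) * K.starProjection = 0 := by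
      rw [sub_mul, hmul, hK.isIdempotentElem.eq, sub_self]
    exact congr($this x)
  have hy := K.sub_starProjection_mem_orthogonal x
  have hKy := (Submodule.starProjection_apply_eq_zero_iff K).2 hy
  have e : inner ℂ ((Ω - K.starProjection) x) x =
      inner ℂ (Ω (x - K.starProjection x)) (x - K.starProjection x) := by
    have e1 : Ω (x - K.starProjection x) = (Ω - K.starProjection) x := by
      have : (Ω - K.starProjection) (x - K.starProjection x) = (Ω - K.starProjection) x := by
        rw [map_sub (Ω - K.starProjection), hXQ, sub_zero]
      rw [← this, sub_apply, hKy, sub_zero]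
    rw [e1, inner_sub_right,
      (IsSelfAdjoint.of_nonneg hX).isSymmetric.apply_clm x (K.starProjection x), hXQ,
      inner_zero_right, sub_zero]
  rw [e]
  refine (h _ hy).trans ?_
  gcongr
  exact IsStarProjection.norm_sub_le hK x

end Order

/-! ### States, passing probabilities and the number of tests -/

section Verification

variable {V : Type*} [Fintype V] [DecidableEq V] {d : V → ℕ}

theorem passProb_sub_left (S T σ : Op d) : passProb (S - T) σ = passProb S σ - passProb T σ := by
  simp [passProb, sub_mul]

theorem passProb_smul_left (r : ℝ) (T σ : Op d) :
    passProb ((r : ℂ) • T) σ = r * passProb T σ := by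
  simp [passProb]

theorem passProb_add_right (T σ τ : Op d) : passProb T (σ + τ) = passProb T σ + passProb T τ := by
  simp [passProb, mul_add]

theorem passProb_smul_right (r : ℝ) (T σ : Op d) :
    passProb T ((r : ℂ) • σ) = r * passProb T σ := by
  simp [passProb]

theorem passProb_one {σ : Op d} (hσ : IsState σ) : passProb 1 σ = 1 := by
  simp [passProb, hσ.2]

theorem passProb_rankOne (T : Op d) (u : Hilb d) :
    passProb T (InnerProductSpace.rankOne ℂ u u) = (inner ℂ u (T u)).re := by
  rw [passProb, ContinuousLinearMap.mul_def, InnerProductSpace.comp_rankOne,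
    InnerProductSpace.trace_rankOne]

theorem passProb_nonneg {T σ : Op d} (hT : 0 ≤ T) (hσ : 0 ≤ σ) : 0 ≤ passProb T σ := by
  rw [ContinuousLinearMap.nonneg_iff_isPositive,
    ContinuousLinearMap.isPositive_iff_eq_sum_rankOne] at hσ
  obtain ⟨n, u, rfl⟩ := hσ
  have h : passProb T (∑ i, InnerProductSpace.rankOne ℂ (u i) (u i)) =
      ∑ i, passProb T (InnerProductSpace.rankOne ℂ (u i) (u i)) := by
    simp [passProb, Finset.mul_sum]
  rw [h]
  refine Finset.sum_nonneg fun i _ => ?_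
  rw [passProb_rankOne]
  have := re_inner_nonneg hT (u i)
  rwa [(IsSelfAdjoint.of_nonneg hT).isSymmetric.apply_clm] at this

theorem passProb_mono {S T σ : Op d} (h : S ≤ T) (hσ : 0 ≤ σ) : passProb S σ ≤ passProb T σ := by
  have := passProb_nonneg (sub_nonneg.2 h) hσ
  rw [passProb_sub_left] at this
  linarith

theorem isState_rankOne {u : Hilb d} (hu : ‖u‖ = 1) :
    IsState (InnerProductSpace.rankOne ℂ u u) := by
  refine ⟨(ContinuousLinearMap.nonneg_iff_isPositive _).2
    (InnerProductSpace.isPositive_rankOne_self u), ?_⟩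
  rw [InnerProductSpace.trace_rankOne, inner_self_eq_norm_sq_to_K, hu]
  simp

theorem IsState.mix {σ τ : Op d} (hσ : IsState σ) (hτ : IsState τ) {r : ℝ} (h0 : 0 ≤ r)
    (h1 : r ≤ 1) : IsState (((1 - r : ℝ) : ℂ) • σ + (r : ℂ) • τ) := by
  refine ⟨add_nonneg (smul_nonneg_of_nonneg hσ.1 (sub_nonneg.2 h1))
    (smul_nonneg_of_nonneg hτ.1 h0), ?_⟩
  simp [hσ.2, hτ.2]

theorem prod_le_pow_of_sum_le {n : ℕ} {a : Fin n → ℝ} (ha : ∀ i, 0 ≤ a i) {c : ℝ}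
    (h : ∑ i, a i ≤ n * c) : ∏ i, a i ≤ c ^ n := by
  rcases n.eq_zero_or_pos with rfl | hn
  · simp
  have hn' : (0 : ℝ) < n := by exact_mod_cast hn
  have h1 := Real.geom_mean_le_arith_mean Finset.univ (fun _ => (1 : ℝ)) a (by simp)
    (by simpa using hn) fun i _ => ha i
  simp only [Real.rpow_one, Finset.sum_const, Finset.card_univ, Fintype.card_fin, nsmul_eq_mul,
    mul_one, one_mul] at h1
  have h0 : 0 ≤ ∏ i, a i := Finset.prod_nonneg fun i _ => ha i
  rw [← Real.rpow_inv_natCast_pow h0 hn.ne']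
  refine pow_le_pow_left₀ (Real.rpow_nonneg h0 _) (h1.trans ?_) n
  rw [div_le_iff₀ hn']
  linarith

/-- The verification operator `Ω` passes only the range of `Q` perfectly, so that `n` tests
suffice if and only if `(1 - ν ε)ⁿ ≤ δ`. -/
theorem verifies_iff {K : Submodule ℂ (Hilb d)} {Ω : Op d} (hΩ : 0 ≤ Ω)
    (hΩK : ∀ x ∈ K, Ω x = x) (hK : ∃ ψ ∈ K, ψ ≠ 0) (hK' : ∃ ψ ∈ Kᗮ, ψ ≠ 0)
    (hν : 0 ≤ verificationGap K.starProjection Ω)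
    {ε δ : ℝ} (hε0 : 0 ≤ ε) (hε1 : ε ≤ 1) (n : ℕ) :
    Verifies K.starProjection Ω ε δ n ↔
      (1 - verificationGap K.starProjection Ω * ε) ^ n ≤ δ := by
  set Q := K.starProjection with hQdef
  set ν := verificationGap Q Ω with hνdef
  have hQ : IsStarProjection Q := isStarProjection_starProjection
  obtain ⟨hle, hmul⟩ := starProjection_le hΩ hΩK
  constructor
  · intro h
    obtain ⟨ψ, hψK, hψ0⟩ := hK
    obtain ⟨χ, hχK, hχ0⟩ := hK'
    have : Nontrivial (Hilb d) := ⟨ψ, 0, hψ0⟩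
    -- A top eigenvector of Ω - Q is orthogonal to K if its eigenvalue is nonzero; if Ω = Q, any
    -- vector of Kᗮ serves.
    obtain ⟨τ, hτK, hτ0, hτ⟩ : ∃ τ ∈ Kᗮ, τ ≠ 0 ∧ (Ω - Q) τ = (‖Ω - Q‖ : ℂ) • τ := by
      obtain ⟨v, hv0, hv⟩ := exists_apply_eq_norm_smul (sub_nonneg.2 hle)
      rcases eq_or_ne ‖Ω - Q‖ 0 with h0 | h0
      · refine ⟨χ, hχK, hχ0, ?_⟩
        rw [h0, norm_eq_zero.1 h0]; simp
      · refine ⟨v, ?_, hv0, hv⟩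
        rw [← Submodule.starProjection_apply_eq_zero_iff K]
        have h' : Q * (Ω - Q) = 0 := by
          have := congr(star $hmul)
          rw [star_mul, hQ.isSelfAdjoint.star_eq, (IsSelfAdjoint.of_nonneg hΩ).star_eq] at this
          rw [mul_sub, this, hQ.isIdempotentElem.eq, sub_self]
        have h'' : Q ((Ω - Q) v) = 0 := congr($h' v)
        rw [hv, map_smul, smul_eq_zero] at h''
        exact h''.resolve_left (by exact_mod_cast h0)
    have hunit : ∀ {u : Hilb d}, u ≠ 0 → ‖(((‖u‖⁻¹ : ℝ)) : ℂ) • u‖ = 1 := fun hu => by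
      rw [norm_smul]
      simp [hu]
    set ψ' : Hilb d := ((‖ψ‖⁻¹ : ℝ) : ℂ) • ψ
    set τ' : Hilb d := ((‖τ‖⁻¹ : ℝ) : ℂ) • τ
    have hψ' : ‖ψ'‖ = 1 := hunit hψ0
    have hτ' : ‖τ'‖ = 1 := hunit hτ0
    have hψK' : ψ' ∈ K := K.smul_mem _ hψK
    have hτK' : τ' ∈ Kᗮ := Kᗮ.smul_mem _ hτK
    have hQψ : Q ψ' = ψ' := Submodule.starProjection_eq_self_iff.2 hψK'
    have hQτ : Q τ' = 0 := (Submodule.starProjection_apply_eq_zero_iff K).2 hτK'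
    have hΩτ : Ω τ' = ((1 - ν : ℝ) : ℂ) • τ' := by
      have e : (Ω - Q) τ' = (‖Ω - Q‖ : ℂ) • τ' := by
        simp only [τ', map_smul, hτ]
        rw [smul_comm]
      rw [sub_apply, hQτ, sub_zero] at e
      rw [e, hνdef, verificationGap]
      simp
    have inn : ∀ {u : Hilb d}, ‖u‖ = 1 → inner ℂ u u = (1 : ℂ) := fun hu => by
      rw [inner_self_eq_norm_sq_to_K, hu]; simp
    -- The extremal state: fidelity exactly 1 - ε, all the infidelity placed on the state outside K
    -- that passes most easily.
    set σ : Op d := ((1 - ε : ℝ) : ℂ) • InnerProductSpace.rankOne ℂ ψ' ψ' +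
      (ε : ℂ) • InnerProductSpace.rankOne ℂ τ' τ' with hσ
    have hσs : IsState σ := (isState_rankOne hψ').mix (isState_rankOne hτ') hε0 hε1
    have p1 : passProb Q σ = 1 - ε := by
      rw [hσ, passProb_add_right, passProb_smul_right, passProb_smul_right, passProb_rankOne,
        passProb_rankOne, hQψ, hQτ, inn hψ']
      simp
    have p2 : passProb Ω σ = 1 - ν * ε := by
      rw [hσ, passProb_add_right, passProb_smul_right, passProb_smul_right, passProb_rankOne,
        passProb_rankOne, hΩK _ hψK', hΩτ, inn hψ', inner_smul_right, inn hτ', mul_one,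
        Complex.ofReal_re, Complex.one_re]
      ring
    have := h (fun _ => σ) (fun _ => hσs) (by simp [p1, mul_sub])
    simpa [p2] using this
  · intro h σ hσ hsum
    have hb : Ω ≤ 1 - (ν : ℂ) • (1 - Q) := le_one_sub_smul hQ hle hmul le_rfl
    have hp : ∀ i, passProb Ω (σ i) ≤ 1 - ν * (1 - passProb Q (σ i)) := fun i => by
      have := passProb_mono hb (hσ i).1
      rwa [passProb_sub_left, passProb_smul_left, passProb_sub_left, passProb_one (hσ i)] at this
    refine (prod_le_pow_of_sum_le (fun i => passProb_nonneg hΩ (hσ i).1) ?_).trans h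
    refine (Finset.sum_le_sum fun i _ => hp i).trans ?_
    rw [Finset.sum_sub_distrib, ← Finset.mul_sum, Finset.sum_sub_distrib]
    simp only [Finset.sum_const, Finset.card_univ, Fintype.card_fin, nsmul_eq_mul, mul_one]
    nlinarith

end Verification

/-! ### The ground space, the spectral gap and the detectability lemma -/

section GroundSpace

variable {V : Type*} [Fintype V] [DecidableEq V] {d : V → ℕ}

theorem ActsOn.one_sub {e : Finset V} {T : Op d} (h : ActsOn e T) : ActsOn e (1 - T) := by
  obtain ⟨A, rfl⟩ := h
  refine ⟨1 - A, ?_⟩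
  have : extendMatrix e (1 - A) = 1 - extendMatrix e A := by
    ext x y
    rw [Matrix.sub_apply]
    by_cases h : ∀ v, v ∉ e → x v = y v
    · simp only [extendMatrix, if_pos h]
      by_cases hxy : x = y
      · subst hxy; simp
      · have : (fun v : e => x v) ≠ fun v : e => y v := fun h' => hxy <| funext fun v => by
          by_cases hv : v ∈ e
          · exact congr($h' ⟨v, hv⟩)
          · exact h v hv
        simp [hxy, this]
    · have hxy : x ≠ y := fun h' => h fun v _ => congr($h' v)
      simp [extendMatrix, h, hxy]
  rw [this, map_sub, map_one]

namespace Hamiltonian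

variable (H : Hamiltonian d)

theorem isStarProjection_Q {e : Finset V} (he : e ∈ H.edges) : IsStarProjection (H.Q e) :=
  (H.isProj e he).one_sub

theorem re_inner_op (x : Hilb d) : (inner ℂ (H.op x) x).re = ∑ e ∈ H.edges, ‖H.P e x‖ ^ 2 := by
  rw [op, sum_apply, sum_inner, Complex.re_sum]
  exact Finset.sum_congr rfl fun e he => IsStarProjection.re_inner_self (H.isProj e he) x

theorem op_isSymmetric : (H.op : Hilb d →ₗ[ℂ] Hilb d).IsSymmetric := by
  intro x y
  change inner ℂ (H.op x) y = inner ℂ x (H.op y)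
  rw [op, sum_apply, sum_apply, sum_inner, inner_sum]
  exact Finset.sum_congr rfl fun e he => IsStarProjection.inner_apply (H.isProj e he) x y

/-- The ground space of `H`. -/
def ground : Submodule ℂ (Hilb d) := LinearMap.ker (H.op : Hilb d →ₗ[ℂ] Hilb d)

/-- ⟨Hx, x⟩ is the sum of the ‖P_e x‖², so it vanishes only if every term does. -/
theorem mem_ground {x : Hilb d} : x ∈ H.ground ↔ ∀ e ∈ H.edges, H.P e x = 0 := by
  constructor
  · intro h e he
    have h0 : H.op x = 0 := h
    have h1 := H.re_inner_op x
    rw [h0, inner_zero_left, Complex.zero_re, eq_comm,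
      Finset.sum_eq_zero_iff_of_nonneg fun _ _ => sq_nonneg _] at h1
    simpa using h1 e he
  · intro h
    change H.op x = 0
    rw [op, sum_apply]
    exact Finset.sum_eq_zero h

theorem Q_apply_of_mem_ground {x : Hilb d} (hx : x ∈ H.ground) {e : Finset V} (he : e ∈ H.edges) :
    H.Q e x = x := by
  simp [Q, H.mem_ground.1 hx e he]

theorem prod_Q_mem_orthogonal {L : List (Finset V)} (hL : ∀ e ∈ L, e ∈ H.edges) {y : Hilb d}
    (hy : y ∈ H.groundᗮ) : (L.map H.Q).prod y ∈ H.groundᗮ := by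
  induction L with
  | nil => simpa using hy
  | cons a L ih =>
    have ha := hL a List.mem_cons_self
    rw [List.map_cons, List.prod_cons, mul_apply_eq_comp, Submodule.mem_orthogonal]
    intro u hu
    rw [← IsStarProjection.inner_apply (H.isStarProjection_Q ha), H.Q_apply_of_mem_ground hu ha]
    exact (Submodule.mem_orthogonal _ _).1 (ih fun e he => hL e (List.mem_cons_of_mem _ he)) u hu

open Module in
theorem finite_nonzero_eigenvalues :
    {x : ℝ | x ≠ 0 ∧ End.HasEigenvalue (H.op : End ℂ (Hilb d)) (x : ℂ)}.Finite := by
  refine Set.Finite.subset ((End.finite_hasEigenvalue (H.op : End ℂ (Hilb d))).preimage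
    (Complex.ofReal_injective.injOn)) fun x hx => hx.2

theorem gap_mul_sq_norm_le {x : Hilb d} (hx : x ∈ H.groundᗮ) :
    H.gap * ‖x‖ ^ 2 ≤ ∑ e ∈ H.edges, ‖H.P e x‖ ^ 2 := by
  rw [← H.re_inner_op]
  -- An eigenvalue below γ can only be 0, and its eigenvectors are ground states.
  refine mul_sq_norm_le_re_inner H.op_isSymmetric x _ fun μ b hb hlt => ?_
  by_cases h0 : μ = 0
  · refine (Submodule.mem_orthogonal _ _).1 hx b ?_
    have := hb.apply_eq_smul
    rw [h0, Complex.ofReal_zero, zero_smul] at this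
    exact this
  · exact absurd (csInf_le H.finite_nonzero_eigenvalues.bddBelow
      ⟨h0, Module.End.hasEigenvalue_of_hasEigenvector hb⟩) (not_le.2 hlt)

theorem gap_pos (h : ∃ x, x ∉ H.ground) : 0 < H.gap := by
  -- Needed because `sInf ∅ = 0`. A nonempty finite set attains its infimum, so γ is a genuine
  -- nonzero eigenvalue.
  have hne : {x : ℝ | x ≠ 0 ∧
      Module.End.HasEigenvalue (H.op : Module.End ℂ (Hilb d)) (x : ℂ)}.Nonempty := by
    by_contra hc
    rw [Set.not_nonempty_iff_eq_empty, Set.eq_empty_iff_forall_notMem] at hc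
    obtain ⟨x, hx⟩ := h
    apply hx
    have h0 := re_inner_eq_sum_eigenvalues H.op_isSymmetric x
    rw [Finset.sum_eq_zero] at h0
    · rw [H.mem_ground]
      intro e he
      have h1 := H.re_inner_op x
      rw [show (inner ℂ (H.op x) x).re = 0 from h0, eq_comm,
        Finset.sum_eq_zero_iff_of_nonneg fun _ _ => sq_nonneg _] at h1
      simpa using h1 e he
    · intro i _
      have : H.op_isSymmetric.eigenvalues rfl i = 0 := by
        by_contra h1
        exact hc _ ⟨h1, H.op_isSymmetric.hasEigenvalue_eigenvalues rfl i⟩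
      rw [this, zero_mul]
  obtain ⟨h0, hev⟩ := hne.csInf_mem H.finite_nonzero_eigenvalues
  refine lt_of_le_of_ne ?_ (Ne.symm h0)
  refine eigenvalue_nonneg_of_nonneg hev fun x => ?_
  have hsym : inner ℂ x (H.op x) = inner ℂ (H.op x) x := (H.op_isSymmetric x x).symm
  change 0 ≤ (inner ℂ x (H.op x)).re
  rw [hsym, H.re_inner_op]
  positivity

theorem exists_not_commute (hg : 1 ≤ H.noncommDegree) :
    ∃ e ∈ H.edges, ∃ e' ∈ H.edges, e ≠ e' ∧ ¬ Commute (H.P e) (H.P e') := by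
  by_contra! hc
  have : H.noncommDegree = 0 := by
    rw [noncommDegree, ← bot_eq_zero, Finset.sup_eq_bot_iff]
    intro e he
    simp only [bot_eq_zero', Finset.card_eq_zero, Finset.filter_eq_empty_iff]
    exact fun e' he' h => h.2 (hc e he e' he' h.1.symm)
  omega

theorem exists_notMem_ground (hg : 1 ≤ H.noncommDegree) : ∃ x, x ∉ H.ground := by
  obtain ⟨e, he, e', he', -, hc⟩ := H.exists_not_commute hg
  by_contra! h
  have : H.P e = 0 := by
    ext x : 1
    exact H.mem_ground.1 (h x) e he
  rw [this] at hc
  exact hc (Commute.zero_left _)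

theorem pairSingular_le_one {e e' : Finset V} (he : e ∈ H.edges) (he' : e' ∈ H.edges) :
    H.pairSingular e e' ≤ 1 :=
  topSingular_le_one (H.isProj e he) (H.isProj e' he')

theorem maxSingular_le_one : H.maxSingular ≤ 1 := by
  refine Real.sSup_le ?_ zero_le_one
  rintro x ⟨e, he, e', he', -, rfl⟩
  exact H.pairSingular_le_one he he'

theorem pairSingular_le_maxSingular {e e' : Finset V} (he : e ∈ H.edges) (he' : e' ∈ H.edges)
    (h : e ≠ e') : H.pairSingular e e' ≤ H.maxSingular := by
  refine le_csSup ⟨1, ?_⟩ ⟨e, he, e', he', h, rfl⟩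
  rintro x ⟨e, he, e', he', -, rfl⟩
  exact H.pairSingular_le_one he he'

/-- A non-commuting pair has a singular value other than 0 and 1. This keeps the denominator s²g²
away from zero. -/
theorem maxSingular_pos (hg : 1 ≤ H.noncommDegree) : 0 < H.maxSingular := by
  obtain ⟨e, he, e', he', hne, hc⟩ := H.exists_not_commute hg
  refine lt_of_lt_of_le ?_ (H.pairSingular_le_maxSingular he he' hne)
  refine lt_of_le_of_ne (topSingular_nonneg _) fun h => hc ?_
  exact commute_of_topSingular_eq_zero (H.isProj e he) (H.isProj e' he') h.symm

/-- The parameter `γ / (s² g²)` of the detectability lemma. -/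
def ratio : ℝ := H.gap / (H.maxSingular ^ 2 * H.noncommDegree ^ 2)

theorem ratio_pos (hg : 1 ≤ H.noncommDegree) : 0 < H.ratio := by
  have h1 := H.gap_pos (H.exists_notMem_ground hg)
  have h2 := H.maxSingular_pos hg
  have h3 : (0 : ℝ) < H.noncommDegree := by exact_mod_cast hg
  unfold ratio
  positivity

/-- **Detectability lemma**. -/
theorem norm_prod_Q_le (hg : 1 ≤ H.noncommDegree) {L : List (Finset V)} (hnd : L.Nodup)
    (hL : ∀ e, e ∈ L ↔ e ∈ H.edges) {ψ : Hilb d} (hψ : ψ ∈ H.groundᗮ) :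
    ‖(L.map H.Q).prod ψ‖ ≤ 1 / √(1 + H.ratio) * ‖ψ‖ := by
  classical
  have hs := H.maxSingular_pos hg
  have hg0 : (0 : ℝ) < H.noncommDegree := by exact_mod_cast hg
  have hr := H.ratio_pos hg
  have key := sum_sq_norm_apply_prod_le (P := H.P) hs.le ψ L hnd
    (fun i hi => H.isProj i ((hL i).1 hi))
    (fun i hi j hj hij x => (norm_apply_sub_le (H.isProj i ((hL i).1 hi))
      (H.isProj j ((hL j).1 hj)) x).trans (by
        gcongr
        exact H.pairSingular_le_maxSingular ((hL i).1 hi) ((hL j).1 hj) hij))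
    H.noncommDegree H.edges hL fun i hi => by
      refine le_trans (le_of_eq ?_) (Finset.le_sup hi)
      congr
  -- The image stays orthogonal to the ground space, so the gap inequality applies to it.
  have hmem := H.prod_Q_mem_orthogonal (fun e he => (hL e).1 he) hψ
  have h1 := (H.gap_mul_sq_norm_le hmem).trans key
  change _ ≤ _ * (‖ψ‖ ^ 2 - ‖(L.map H.Q).prod ψ‖ ^ 2) at h1
  set φ := (L.map H.Q).prod ψ
  have h2 : (1 + H.ratio) * ‖φ‖ ^ 2 ≤ ‖ψ‖ ^ 2 := by
    have e : H.gap = H.ratio * (H.maxSingular ^ 2 * H.noncommDegree ^ 2) := by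
      unfold ratio; field_simp
    rw [e] at h1
    have : H.ratio * ‖φ‖ ^ 2 ≤ ‖ψ‖ ^ 2 - ‖φ‖ ^ 2 := by
      refine le_of_mul_le_mul_left ?_
        (show 0 < H.maxSingular ^ 2 * (H.noncommDegree : ℝ) ^ 2 by positivity)
      linarith
    linarith
  have h3 : 0 < √(1 + H.ratio) := Real.sqrt_pos.2 (by linarith)
  rw [div_mul_eq_mul_div, one_mul, le_div_iff₀ h3]
  refine le_of_sq_le_sq ?_ (norm_nonneg _)
  rw [mul_pow, Real.sq_sqrt (by linarith)]
  linarith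

end Hamiltonian

end GroundSpace

/-! ### Elementary bounds on f_m -/

section Bounds

theorem f_eq (m : ℕ) {x : ℝ} (hx : 0 < x) :
    f m x = if m = 2 then 1 - 1 / √(1 + x)
      else (1 - 1 / √(1 + x)) / (1 + 1 / √(1 + x)) := by
  have h : 0 < √(1 + x) := Real.sqrt_pos.2 (by linarith)
  unfold f
  split_ifs
  · field_simp
  · field_simp

theorem one_div_sqrt_lt_one {x : ℝ} (hx : 0 < x) : 1 / √(1 + x) < 1 := by
  have h : 1 < √(1 + x) := Real.lt_sqrt_of_sq_lt (by linarith)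
  rw [div_lt_one (by linarith)]
  exact h

theorem f_pos (m : ℕ) {x : ℝ} (hx : 0 < x) : 0 < f m x := by
  have h : 1 < √(1 + x) := Real.lt_sqrt_of_sq_lt (by linarith)
  unfold f
  split_ifs <;> exact div_pos (by linarith) (by linarith)

theorem f_le_one (m : ℕ) {x : ℝ} (hx : 0 < x) : f m x ≤ 1 := by
  have h : 1 < √(1 + x) := Real.lt_sqrt_of_sq_lt (by linarith)
  unfold f
  split_ifs
  · rw [div_le_one (by linarith)]; linarith
  · rw [div_le_one (by linarith)]; linarith

theorem div_six_le_f (m : ℕ) {x y : ℝ} (hx : 0 < x) (hx1 : x ≤ 1) (hxy : x ≤ y) :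
    x / 6 ≤ f m y := by
  have hx2 : √(1 + x) ^ 2 = 1 + x := Real.sq_sqrt (by linarith)
  have h1 : 1 < √(1 + x) := Real.lt_sqrt_of_sq_lt (by linarith)
  have hle : √(1 + x) ≤ √(1 + y) := Real.sqrt_le_sqrt (by linarith)
  set a := √(1 + x)
  set b := √(1 + y)
  -- Slightly above √2. Since x = (a - 1)(a + 1), the next claim amounts to (a + 1)² ≤ 6.
  have ha : a ≤ 1.4143 := by nlinarith
  have h2 : x / 6 ≤ (a - 1) / (a + 1) := by
    rw [le_div_iff₀ (by linarith)]
    have : x = (a - 1) * (a + 1) := by linarith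
    rw [this]
    nlinarith [mul_nonneg (sub_nonneg.2 h1.le) (sub_nonneg.2 ha)]
  have h3 : (a - 1) / (a + 1) ≤ (b - 1) / (b + 1) := by
    rw [div_le_div_iff₀ (by linarith) (by linarith)]
    nlinarith
  have h4 : (b - 1) / (b + 1) ≤ (b - 1) / b :=
    div_le_div_of_nonneg_left (by linarith) (by linarith) (by linarith)
  unfold f
  split_ifs
  · exact h2.trans (h3.trans h4)
  · exact h2.trans h3

end Bounds

/-! ### The matching protocol -/

variable {V : Type*} [Fintype V] [DecidableEq V] {d : V → ℕ} {H : Hamiltonian d}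

namespace BondVerification

variable (B : BondVerification H)

theorem nonneg {e : Finset V} (he : e ∈ H.edges) : 0 ≤ B.Ω e :=
  ((ContinuousLinearMap.nonneg_iff_isPositive _).2
    (.of_isStarProjection (H.isStarProjection_Q he))).trans (B.Q_le e he)

theorem norm_sub_le_one {e : Finset V} (he : e ∈ H.edges) : ‖B.Ω e - H.Q e‖ ≤ 1 := by
  have h0 := sub_nonneg.2 (B.Q_le e he)
  refine norm_le_of_re_inner_le h0 zero_le_one fun x => ?_
  have h1 : B.Ω e - H.Q e ≤ 1 := (sub_le_self _ ((ContinuousLinearMap.nonneg_iff_isPositive _).2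
    (.of_isStarProjection (H.isStarProjection_Q he)))).trans (B.le_one e he)
  refine (re_inner_mono h1 x).trans (le_of_eq ?_)
  rw [one_apply_eq_self, one_mul]
  exact inner_self_eq_norm_sq (𝕜 := ℂ) x

theorem minGap_nonneg : 0 ≤ B.minGap := by
  refine Real.sInf_nonneg ?_
  rintro x ⟨e, he, rfl⟩
  exact sub_nonneg.2 (B.norm_sub_le_one he)

theorem minGap_le {e : Finset V} (he : e ∈ H.edges) : B.minGap ≤ 1 - ‖B.Ω e - H.Q e‖ := by
  refine csInf_le ⟨0, ?_⟩ ⟨e, he, rfl⟩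
  rintro x ⟨e, he, rfl⟩
  exact sub_nonneg.2 (B.norm_sub_le_one he)

theorem minGap_le_one {e : Finset V} (he : e ∈ H.edges) : B.minGap ≤ 1 :=
  (B.minGap_le he).trans (sub_le_self _ (norm_nonneg _))

theorem apply_of_mem_ground {x : Hilb d} (hx : x ∈ H.ground) {e : Finset V} (he : e ∈ H.edges) :
    B.Ω e x = x := by
  have := congr($(B.mul_Q e he) x)
  rwa [mul_apply_eq_comp, H.Q_apply_of_mem_ground hx he] at this

end BondVerification

theorem isLocal_Q {e : Finset V} (he : e ∈ H.edges) : ActsOn e (H.Q e) :=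
  (H.isLocal e he).one_sub

section Protocol

variable (B : BondVerification H) {m : ℕ} (C : MatchingCover H.edges m)

theorem noncommProd_eq_prod_toList {α β : Type*} [Monoid β] (s : Finset α) (f : α → β) (comm) :
    s.noncommProd f comm = (s.toList.map f).prod := by
  classical
  have := Finset.noncommProd_toFinset s.toList f (by simpa using comm) s.nodup_toList
  rw [← this]
  congr 1
  simp

theorem testOp_eq (l : Fin m) : testOp B C l = ((C.M l).toList.map B.Ω).prod :=
  noncommProd_eq_prod_toList _ _ _

/-- The predicate `p` will select the edges assigned to this matching: an edge may lie in several
matchings, but the detectability lemma needs each edge once. Disjointness supplies all the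
commutation. -/
theorem testOp_bound (p : Finset V → Bool) (hE : H.edges.Nonempty) (l : Fin m) :
    0 ≤ testOp B C l ∧ IsStarProjection (((C.M l).toList.filter p).map H.Q).prod ∧
      testOp B C l ≤ 1 - (B.minGap : ℂ) • (1 - (((C.M l).toList.filter p).map H.Q).prod) := by
  rw [testOp_eq]
  obtain ⟨e₀, he₀⟩ := hE
  have hmem : ∀ e ∈ (C.M l).toList, e ∈ H.edges := fun e he =>
    C.subset l (Finset.mem_toList.1 he)
  have hdisj : ∀ e ∈ (C.M l).toList, ∀ e' ∈ (C.M l).toList, e ≠ e' → Disjoint e e' :=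
    fun e he e' he' => C.matching l e (Finset.mem_toList.1 he) e' (Finset.mem_toList.1 he')
  refine list_prod_le_one_sub_smul B.minGap_nonneg (B.minGap_le_one he₀) p _
    (C.M l).nodup_toList (fun e he => H.isStarProjection_Q (hmem e he))
    (fun e he => B.nonneg (hmem e he)) (fun e he => B.le_one e (hmem e he))
    (fun e he => le_one_sub_smul (H.isStarProjection_Q (hmem e he)) (B.Q_le e (hmem e he))
      (B.mul_Q e (hmem e he)) (B.minGap_le (hmem e he)))
    (fun e he e' he' hne => ?_) (fun e he e' he' hne => ?_) (fun e he e' he' hne => ?_)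
  · exact ActsOn.commute (hdisj e he e' he' hne) (B.isLocal e (hmem e he))
      (B.isLocal e' (hmem e' he'))
  · exact ActsOn.commute (hdisj e he e' he' hne) (B.isLocal e (hmem e he))
      (isLocal_Q (hmem e' he'))
  · exact ActsOn.commute (hdisj e he e' he' hne) (isLocal_Q (hmem e he))
      (isLocal_Q (hmem e' he'))

theorem testOp_apply_of_mem_ground {x : Hilb d} (hx : x ∈ H.ground) (l : Fin m) :
    testOp B C l x = x := by
  rw [testOp_eq]
  have hmem : ∀ e ∈ (C.M l).toList, e ∈ H.edges := fun e he =>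
    C.subset l (Finset.mem_toList.1 he)
  generalize (C.M l).toList = L at hmem ⊢
  induction L with
  | nil => simp
  | cons a L ih =>
    rw [List.map_cons, List.prod_cons, mul_apply_eq_comp,
      ih fun e he => hmem e (List.mem_cons_of_mem _ he),
      B.apply_of_mem_ground hx (hmem a List.mem_cons_self)]

theorem matchingOp_eq : matchingOp B C = (((m : ℝ)⁻¹ : ℝ) : ℂ) • ∑ l, testOp B C l := by
  simp [matchingOp]

theorem matchingOp_nonneg (hE : H.edges.Nonempty) : 0 ≤ matchingOp B C := by
  rw [matchingOp_eq]
  exact smul_nonneg_of_nonneg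
    (Finset.sum_nonneg fun l _ => (testOp_bound B C (fun _ => true) hE l).1) (by positivity)

theorem matchingOp_apply_of_mem_ground (hm : m ≠ 0) {x : Hilb d} (hx : x ∈ H.ground) :
    matchingOp B C x = x := by
  have : (m : ℂ) ≠ 0 := by exact_mod_cast hm
  rw [matchingOp, smul_apply, sum_apply,
    Finset.sum_congr rfl fun l _ => testOp_apply_of_mem_ground B C hx l]
  rw [Finset.sum_const, Finset.card_univ, Fintype.card_fin, ← Nat.cast_smul_eq_nsmul ℂ, smul_smul,
    inv_mul_cancel₀ this, one_smul]

/-- Concatenated over l, the lists of edges labelled l enumerate the edge set without repetition, so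
the product of the R_l is one to which the detectability lemma applies. -/
theorem f_mul_sq_norm_le (hg : 1 ≤ H.noncommDegree) (lbl : Finset V → Fin m)
    (hlbl : ∀ e ∈ H.edges, e ∈ C.M (lbl e))
    (hproj : ∀ l, IsStarProjection (((C.M l).toList.filter
      fun e => decide (lbl e = l)).map H.Q).prod) {y : Hilb d} (hy : y ∈ H.groundᗮ) :
    f m H.ratio * ‖y‖ ^ 2 ≤ ∑ l, ‖y - (((C.M l).toList.filter
      fun e => decide (lbl e = l)).map H.Q).prod y‖ ^ 2 := by
  set L : Fin m → List (Finset V) := fun l => (C.M l).toList.filter fun e => decide (lbl e = l)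
    with hLdef
  have hmemL : ∀ l e, e ∈ L l ↔ e ∈ C.M l ∧ lbl e = l := fun l e => by simp [hLdef]
  have hLE : ∀ l, ∀ e ∈ L l, e ∈ H.edges := fun l e he => C.subset l ((hmemL l e).1 he).1
  have hnd : ((List.finRange m).flatMap L).Nodup := by
    rw [List.nodup_flatMap]
    refine ⟨fun l _ => (C.M l).nodup_toList.filter _, ?_⟩
    refine (List.nodup_finRange m).imp fun {l l'} hne => ?_
    intro e he he'
    exact hne (((hmemL l e).1 he).2.symm.trans ((hmemL l' e).1 he').2)
  have hmem : ∀ e, e ∈ (List.finRange m).flatMap L ↔ e ∈ H.edges := fun e => by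
    rw [List.mem_flatMap]
    exact ⟨fun ⟨l, _, he⟩ => hLE l e he,
      fun he => ⟨lbl e, List.mem_finRange _, (hmemL _ e).2 ⟨hlbl e he, rfl⟩⟩⟩
  have hDL : ∀ {ψ : Hilb d}, ψ ∈ H.groundᗮ →
      ‖((List.finRange m).map fun l => ((L l).map H.Q).prod).prod ψ‖ ≤
        1 / √(1 + H.ratio) * ‖ψ‖ := fun hψ => by
    have := H.norm_prod_Q_le hg hnd hmem hψ
    rwa [List.map_flatMap, List.flatMap, List.prod_flatten, List.map_map] at this
  have hr := H.ratio_pos hg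
  have hc0 : 0 ≤ 1 / √(1 + H.ratio) := by positivity
  rw [f_eq m hr]
  split_ifs with hm2
  · subst hm2
    rw [Fin.sum_univ_two]
    refine mul_sq_norm_le_add_of_norm_mul_le (hproj 0) (hproj 1) y hc0 ?_
    -- The contraction is used at R_1 y, which is still orthogonal to the ground space.
    have := hDL (H.prod_Q_mem_orthogonal (hLE 1) hy)
    simpa [List.finRange_succ] using this
  · have h := mul_sq_norm_le_sum_of_norm_prod_le
      ((List.finRange m).map fun l => ((L l).map H.Q).prod) (fun Q hQ => by
        obtain ⟨l, -, rfl⟩ := List.mem_map.1 hQ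
        exact hproj l) y hc0 (one_div_sqrt_lt_one hr) (hDL hy)
    rw [List.map_map] at h
    rw [Fin.sum_univ_def]
    exact h

theorem re_inner_matchingOp_le (hg : 1 ≤ H.noncommDegree) (hm : m ≠ 0) (hE : H.edges.Nonempty)
    {y : Hilb d} (hy : y ∈ H.groundᗮ) :
    (inner ℂ (matchingOp B C y) y).re ≤ (1 - B.minGap / m * f m H.ratio) * ‖y‖ ^ 2 := by
  -- One matching is chosen for each edge; labels outside the edge set are arbitrary.
  obtain ⟨lbl, hlbl⟩ : ∃ lbl : Finset V → Fin m, ∀ e ∈ H.edges, e ∈ C.M (lbl e) := by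
    have : Nonempty (Fin m) := ⟨⟨0, Nat.pos_of_ne_zero hm⟩⟩
    have h : ∀ e, ∃ l, e ∈ H.edges → e ∈ C.M l := fun e => by
      by_cases he : e ∈ H.edges
      · obtain ⟨l, hl⟩ := C.cover e he
        exact ⟨l, fun _ => hl⟩
      · exact ⟨Classical.arbitrary _, fun h => absurd h he⟩
    choose lbl hlbl using h
    exact ⟨lbl, hlbl⟩
  have key := f_mul_sq_norm_le C hg lbl hlbl
    (fun l => (testOp_bound B C (fun e => decide (lbl e = l)) hE l).2.1) hy
  have hbound : ∀ l, (inner ℂ (testOp B C l y) y).re ≤ ‖y‖ ^ 2 - B.minGap *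
      ‖y - (((C.M l).toList.filter fun e => decide (lbl e = l)).map H.Q).prod y‖ ^ 2 := fun l => by
    obtain ⟨-, hR, hle⟩ := testOp_bound B C (fun e => decide (lbl e = l)) hE l
    refine (re_inner_mono hle y).trans (le_of_eq ?_)
    have h1 := IsStarProjection.re_inner_self hR.one_sub y
    have h2 : (inner ℂ y y).re = ‖y‖ ^ 2 := inner_self_eq_norm_sq (𝕜 := ℂ) y
    rw [sub_apply, inner_sub_left, Complex.sub_re, smul_apply, inner_smul_left,
      Complex.conj_ofReal, Complex.re_ofReal_mul, h1, one_apply_eq_self, h2]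
    rfl
  have hm0 : (0 : ℝ) < m := by exact_mod_cast Nat.pos_of_ne_zero hm
  rw [matchingOp_eq, smul_apply, inner_smul_left, Complex.conj_ofReal, Complex.re_ofReal_mul,
    sum_apply, sum_inner, Complex.re_sum]
  have h3 : ∑ l, (inner ℂ (testOp B C l y) y).re ≤
      m * ‖y‖ ^ 2 - B.minGap * (f m H.ratio * ‖y‖ ^ 2) := by
    refine (Finset.sum_le_sum fun l _ => hbound l).trans ?_
    rw [Finset.sum_sub_distrib, ← Finset.mul_sum, Finset.sum_const, Finset.card_univ,
      Fintype.card_fin, nsmul_eq_mul]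
    exact sub_le_sub_left (mul_le_mul_of_nonneg_left key B.minGap_nonneg) _
  refine (mul_le_mul_of_nonneg_left h3 (by positivity)).trans (le_of_eq ?_)
  field_simp

theorem le_verificationGap_matchingOp (hg : 1 ≤ H.noncommDegree) (hm : m ≠ 0)
    (hE : H.edges.Nonempty) :
    B.minGap / m * f m H.ratio ≤ verificationGap H.groundProj (matchingOp B C) := by
  have hr := H.ratio_pos hg
  have hm1 : (1 : ℝ) ≤ m := by exact_mod_cast Nat.pos_of_ne_zero hm
  obtain ⟨e₀, he₀⟩ := hE
  have h1 : B.minGap / m * f m H.ratio ≤ 1 := by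
    refine mul_le_one₀ ?_ (f_pos m hr).le (f_le_one m hr)
    rw [div_le_one (by linarith)]
    exact (B.minGap_le_one he₀).trans hm1
  have := norm_sub_starProjection_le (K := H.ground) (matchingOp_nonneg B C ⟨e₀, he₀⟩)
    (fun x hx => matchingOp_apply_of_mem_ground B C hm hx) (sub_nonneg.2 h1)
    (fun y hy => re_inner_matchingOp_le B C hg hm ⟨e₀, he₀⟩ hy)
  change _ ≤ 1 - ‖matchingOp B C - H.ground.starProjection‖
  linarith

end Protocol

theorem pow_le_iff_ceil_log_div_log_le {b δ : ℝ} (hb0 : 0 < b) (hb1 : b < 1) (hδ : 0 < δ) (n : ℕ) :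
    b ^ n ≤ δ ↔ ⌈Real.log δ / Real.log b⌉₊ ≤ n := by
  rw [Nat.ceil_le, div_le_iff_of_neg (Real.log_neg hb0 hb1), ← Real.log_pow,
    Real.log_le_log_iff (by positivity) hδ]

end FrustrationFree

end

theorem theorem1 {V : Type*} [Fintype V] [DecidableEq V] {d : V → ℕ}
    (H : FrustrationFree.Hamiltonian d)
    (hg : 1 ≤ H.noncommDegree) (B : FrustrationFree.BondVerification H) {m : ℕ} (hm : 2 ≤ m)
    (C : FrustrationFree.MatchingCover H.edges m) :
    FrustrationFree.verificationGap H.groundProj (FrustrationFree.matchingOp B C) ≥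
        B.minGap / m * FrustrationFree.f m (H.gap / (H.maxSingular ^ 2 * H.noncommDegree ^ 2)) ∧
    (H.gap ≤ H.noncommDegree ^ 2 →
      B.minGap / m * FrustrationFree.f m (H.gap / (H.maxSingular ^ 2 * H.noncommDegree ^ 2)) ≥
        B.minGap * H.gap / (6 * m * H.noncommDegree ^ 2)) ∧
    ∀ ε δ : ℝ, 0 < ε → ε < 1 → 0 < δ → δ < 1 → 0 < B.minGap →
      ∃ N : ℕ,
        IsLeast {n | FrustrationFree.Verifies H.groundProj (FrustrationFree.matchingOp B C) ε δ n} N ∧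
        N = ⌈Real.log δ /
          Real.log (1 - FrustrationFree.verificationGap H.groundProj (FrustrationFree.matchingOp B C) * ε)⌉₊ ∧
        N ≤ ⌈m * Real.log δ⁻¹ / (B.minGap * ε *
          FrustrationFree.f m (H.gap / (H.maxSingular ^ 2 * H.noncommDegree ^ 2)))⌉₊ ∧
        (H.gap ≤ H.noncommDegree ^ 2 →
          ⌈m * Real.log δ⁻¹ / (B.minGap * ε *
              FrustrationFree.f m (H.gap / (H.maxSingular ^ 2 * H.noncommDegree ^ 2)))⌉₊ ≤
            ⌈6 * m * H.noncommDegree ^ 2 * Real.log δ⁻¹ / (B.minGap * H.gap * ε)⌉₊) := by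

  have hr := H.ratio_pos hg
  have hm0 : m ≠ 0 := by omega
  have hmR : (0 : ℝ) < m := by exact_mod_cast Nat.pos_of_ne_zero hm0
  have hgR : (0 : ℝ) < H.noncommDegree := by exact_mod_cast hg
  obtain ⟨e₀, he₀, -⟩ := H.exists_not_commute hg
  have hE : H.edges.Nonempty := ⟨e₀, he₀⟩
  have hγ := H.gap_pos (H.exists_notMem_ground hg)
  have hs0 := H.maxSingular_pos hg
  have hmain := FrustrationFree.le_verificationGap_matchingOp B C hg hm0 hE
  change _ ≥ B.minGap / m * FrustrationFree.f m H.ratio ∧ (_ → B.minGap / m *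
    FrustrationFree.f m H.ratio ≥ _) ∧ ∀ ε δ : ℝ, 0 < ε → ε < 1 → 0 < δ → δ < 1 → 0 < B.minGap →
      ∃ N : ℕ, _ ∧ _ ∧ N ≤ ⌈m * Real.log δ⁻¹ / (B.minGap * ε *
        FrustrationFree.f m H.ratio)⌉₊ ∧ (_ → ⌈m * Real.log δ⁻¹ / (B.minGap * ε *
        FrustrationFree.f m H.ratio)⌉₊ ≤ _)
  have hf := FrustrationFree.f_pos m hr
  -- Since s ≤ 1, γ/g² is at most γ/(s²g²).
  have hsix : H.gap ≤ H.noncommDegree ^ 2 →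
      H.gap / H.noncommDegree ^ 2 / 6 ≤ FrustrationFree.f m H.ratio := fun h => by
    refine FrustrationFree.div_six_le_f m (by positivity) ((div_le_one (by positivity)).2 h) ?_
    refine div_le_div_of_nonneg_left hγ.le (by positivity) ?_
    exact mul_le_of_le_one_left (by positivity) (pow_le_one₀ hs0.le H.maxSingular_le_one)
  refine ⟨hmain, fun h => ?_, fun ε δ hε0 hε1 hδ0 hδ1 hν => ?_⟩
  · have h1 : B.minGap * H.gap / (6 * m * H.noncommDegree ^ 2) =
        B.minGap / m * (H.gap / H.noncommDegree ^ 2 / 6) := by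
      field_simp
    rw [h1]
    exact mul_le_mul_of_nonneg_left (hsix h) (div_nonneg B.minGap_nonneg hmR.le)
  · set ν := FrustrationFree.verificationGap H.groundProj (FrustrationFree.matchingOp B C)
      with hνdef
    have hν0 : 0 < ν := lt_of_lt_of_le (by positivity) hmain
    have hν1 : ν ≤ 1 := sub_le_self _ (norm_nonneg _)
    have hνε : 0 < ν * ε := mul_pos hν0 hε0
    have hb0 : 0 < 1 - ν * ε := by nlinarith
    have hb1 : 1 - ν * ε < 1 := by linarith
    have hlog : 0 < Real.log δ⁻¹ := Real.log_pos ((one_lt_inv₀ hδ0).2 hδ1)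
    have hiff : ∀ n, FrustrationFree.Verifies H.groundProj (FrustrationFree.matchingOp B C) ε δ n ↔
        ⌈Real.log δ / Real.log (1 - ν * ε)⌉₊ ≤ n := fun n => by
      rw [← FrustrationFree.pow_le_iff_ceil_log_div_log_le hb0 hb1 hδ0]
      refine FrustrationFree.verifies_iff (K := H.ground) (FrustrationFree.matchingOp_nonneg B C hE)
        (fun x hx => FrustrationFree.matchingOp_apply_of_mem_ground B C hm0 hx) ?_ ?_ hν0.le
        hε0.le hε1.le n
      · obtain ⟨ψ, hψ0, hψ⟩ := H.frustrationFree
        exact ⟨ψ, H.mem_ground.2 hψ, hψ0⟩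
      -- Non-commuting projectors are not all zero, so the ground space is proper.
      · obtain ⟨x, hx⟩ := H.exists_notMem_ground hg
        refine Submodule.exists_mem_ne_zero_of_ne_bot fun h => hx ?_
        rw [Submodule.orthogonal_eq_bot_iff] at h
        rw [h]
        trivial
    refine ⟨_, ⟨(hiff _).2 le_rfl, fun n hn => (hiff n).1 hn⟩, rfl, Nat.ceil_le_ceil ?_,
      fun h => Nat.ceil_le_ceil ?_⟩
    · have h1 : Real.log (1 - ν * ε) ≤ -(ν * ε) := by
        have := Real.log_le_sub_one_of_pos hb0
        linarith
      calc Real.log δ / Real.log (1 - ν * ε) = Real.log δ⁻¹ / (-Real.log (1 - ν * ε)) := by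
            rw [Real.log_inv, neg_div_neg_eq]
        _ ≤ Real.log δ⁻¹ / (ν * ε) :=
            div_le_div_of_nonneg_left hlog.le hνε (by linarith)
        _ ≤ Real.log δ⁻¹ / (B.minGap / m * FrustrationFree.f m H.ratio * ε) :=
            div_le_div_of_nonneg_left hlog.le (by positivity)
              (mul_le_mul_of_nonneg_right hmain hε0.le)
        _ = _ := by field_simp
    · calc _ ≤ m * Real.log δ⁻¹ / (B.minGap * ε * (H.gap / H.noncommDegree ^ 2 / 6)) :=
            div_le_div_of_nonneg_left (by positivity) (by positivity)
              (mul_le_mul_of_nonneg_left (hsix h) (by positivity))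
        _ = _ := by field_simp
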